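/- Let $k$ be a field with the discrete topology. **Tate spaces.** Let $\Pi=\{(i,j)\in\mathbb Z^2: i\le j\}$ with the order induced from $\mathbb Z\times\mathbb Z$. A functor $X:\Pi\to \mathbf{Vect}_0(k)$ to finite-dimensional vector spaces is *admissible* if $0\to X_{i,j}\to X_{i,l}\to X_{j,l}\to 0$ is exact for all $i\le j\le l$. The category $\mathcal T$ of Tate spaces is the localization of the category of admissible functors at all morphisms $(X_{\varphi_0(i),\varphi_0(j)})\to (X_{\varphi_1(i),\varphi_1(j)})$, where $X$ is admissible and $\varphi_0\le\varphi_1:\mathbb Z\to\mathbb Z$ are nondecreasing maps tending to $\pm\infty$ at $\pm\infty$. A sequence $X\to Y\to Z$ in $\mathcal T$ is an admissible short exact sequence if it becomes short exact in the abelian category $\mathrm{Ind}\,\mathrm{Pro}(\mathbf{Vect}_0(k))$ under $X\mapsto \text{``}\varinjlim_j\text{''}\text{``}\varprojlim_i\text{''}X_{i,j}$ (where $j\to\infty$ and $i\to-\infty$). **Locally linearly compact spaces.** A Hausdorff linearly topologized $k$-vector space is *linearly compact* if every family of closed affine subspaces with the finite intersection property has nonempty intersection. A Hausdorff linearly topologized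 space $V$ is *locally linearly compact* if it has a linearly compact open subspace $U$; it is *of countable type* if moreover $0$ has a countable base of neighbourhoods and $V/U$ has countable dimension for some such $U$. Let $\mathcal L$ be the category of locally linearly compact $k$-vector spaces of countable type and continuous linear maps. The functor $\Phi(X)=\varinjlim_j\varprojlim_i X_{i,j}$ (limits of topological vector spaces, the $X_{i,j}$ being discrete) is an equivalence of categories $\mathcal T\to\mathcal L$. Call a sequence in $\mathcal L$ an admissible short exact sequence if it is isomorphic to the image under $\Phi$ of an admissible short exact sequence of $\mathcal T$; its first map is then called an admissible monomorphism and its second map an admissible epimorphism. Then: (a) a morphism of $\mathcal L$ is an admissible monomorphism if and only if it is a closed embedding; (b) a morphism $p:B\to C$ of $\mathcal L$ is an admissible epimorphism if and only if it is a continuous surjection such that the canonical bijection $B/\ker p\to C$ is a homeomorphism. -/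

import Mathlib

open CategoryTheory CategoryTheory.Limits

universe u

namespace TateSpaces

noncomputable section

/-! ### The index set `Π = {(i, j) ∈ ℤ × ℤ | i ≤ j}` and bicofinal reindexings -/

/-- The ordered set of pairs of integers `i ≤ j`, with the order induced from `ℤ × ℤ`. -/
abbrev Pairs : Type := {p : ℤ × ℤ // p.1 ≤ p.2}

/-- The element `(i, j)` of `Pairs`. -/
abbrev pair (i j : ℤ) (h : i ≤ j) : Pairs := ⟨(i, j), h⟩

/-- A nondecreasing map `φ : ℤ → ℤ` with `φ → -∞` at `-∞` and `φ → ∞` at `∞`. -/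
structure Bicofinal where
  toFun : ℤ → ℤ
  mono : Monotone toFun
  tendsto_atBot : Filter.Tendsto toFun Filter.atBot Filter.atBot
  tendsto_atTop : Filter.Tendsto toFun Filter.atTop Filter.atTop

/-- The endofunctor `(i, j) ↦ (φ i, φ j)` of `Pairs`. -/
def Bicofinal.onPairs (φ : Bicofinal) : Pairs ⥤ Pairs :=
  Monotone.functor (f := fun p => pair (φ.toFun p.1.1) (φ.toFun p.1.2) (φ.mono p.2))
    fun _ _ h => ⟨φ.mono h.1, φ.mono h.2⟩

/-- For `φ₀ ≤ φ₁`, the natural transformation with components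
`(φ₀ i, φ₀ j) ⟶ (φ₁ i, φ₁ j)`. -/
def Bicofinal.compare {φ₀ φ₁ : Bicofinal} (h : ∀ i, φ₀.toFun i ≤ φ₁.toFun i) :
    φ₀.onPairs ⟶ φ₁.onPairs where
  app p := homOfLE ⟨h p.1.1, h p.1.2⟩

/-! ### Iterated limits of diagrams indexed by `Pairs` -/

/-- `j ↦ (i ↦ (min i j, j))`.  Pulling back along it extends a diagram `X` on `Pairs` to
`ℤ × ℤ`, the value at `(i, j)` being `X (i, j)` if `i ≤ j` and `X (j, j)` if `i > j`. -/
def clamp : ℤ ⥤ ℤ ⥤ Pairs where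
  obj j := Monotone.functor (f := fun i => pair (min i j) j (min_le_right i j))
    fun _ _ h => ⟨min_le_min_right j h, le_refl j⟩
  map {j j'} f := { app := fun i => homOfLE ⟨min_le_min_left i (leOfHom f), leOfHom f⟩ }

theorem map_comp_map_eq {A D : Type*} [Category* A] [Category* D] (F : A ⥤ D) (X : Pairs ⥤ A) {p q r s t : Pairs} (f : p ⟶ q) (g : q ⟶ r)
    (h : r ⟶ s) (f' : p ⟶ t) (g' : t ⟶ s) :
    F.map (X.map f) ≫ F.map (X.map g) ≫ F.map (X.map h) = F.map (X.map f') ≫ F.map (X.map g') := by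
  rw [← F.map_comp, ← F.map_comp, ← F.map_comp, ← X.map_comp, ← X.map_comp, ← X.map_comp]
  exact congrArg (fun t => F.map (X.map t)) (Subsingleton.elim _ _)

section Limits

universe v₁ v₂ v₃ u₁ u₂ u₃

variable {A : Type u₁} [Category.{v₁} A] {D : Type u₂} [Category.{v₂} D]
  {D' : Type u₃} [Category.{v₃} D'] [HasLimitsOfShape ℤ D] [HasColimitsOfShape ℤ D']

/-- `X ↦ (j ↦ lim_{i → -∞} F X_{i,j})`. -/
def innerLim (F : A ⥤ D) : (Pairs ⥤ A) ⥤ (ℤ ⥤ D) where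
  obj X := clamp ⋙ (Functor.whiskeringRight ℤ Pairs D).obj (X ⋙ F) ⋙ lim
  map f := Functor.whiskerLeft clamp
    (Functor.whiskerRight ((Functor.whiskeringRight ℤ Pairs D).map (Functor.whiskerRight f F)) lim)

/-- `X ↦ colim_{j → ∞} G (lim_{i → -∞} F X_{i,j})`. -/
def colimLim (F : A ⥤ D) (G : D ⥤ D') : (Pairs ⥤ A) ⥤ D' :=
  innerLim F ⋙ (Functor.whiskeringRight ℤ D D').obj G ⋙ colim

/-- The functor `ℤ ⥤ ℤ` given by a bicofinal map. -/
def Bicofinal.functor (φ : Bicofinal) : ℤ ⥤ ℤ := φ.mono.functor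

/-- For `φ₀ ≤ φ₁`, the natural transformation with components `φ₀ i ⟶ φ₁ i`. -/
def Bicofinal.functorLE {φ₀ φ₁ : Bicofinal} (h : ∀ i, φ₀.toFun i ≤ φ₁.toFun i) :
    φ₀.functor ⟶ φ₁.functor where
  app i := homOfLE (h i)

theorem Bicofinal.final_functor (φ : Bicofinal) : φ.functor.Final := by
  refine (Monotone.final_functor_iff φ.mono).2 fun j => ?_
  exact (φ.tendsto_atTop.eventually_ge_atTop j).exists

theorem Bicofinal.initial_functor (φ : Bicofinal) : φ.functor.Initial := by
  refine (Monotone.initial_functor_iff φ.mono).2 fun j => ?_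
  exact (φ.tendsto_atBot.eventually_le_atBot j).exists

/-- For monotone `φ`, clamping commutes with reindexing. -/
def clampIso (φ : Bicofinal) (j : ℤ) :
    φ.functor ⋙ clamp.obj (φ.toFun j) ≅ clamp.obj j ⋙ φ.onPairs :=
  NatIso.ofComponents (fun _ => eqToIso (Subtype.ext (Prod.ext (φ.mono.map_min).symm rfl)))
    (fun _ => Subsingleton.elim _ _)

/-- The map `lim_i F X_{i, φ j} ⟶ lim_i F X_{φ i, φ j}`. -/
def reindexApp (F : A ⥤ D) (X : Pairs ⥤ A) (φ : Bicofinal) (j : ℤ) :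
    limit (clamp.obj (φ.toFun j) ⋙ X ⋙ F) ⟶ limit (clamp.obj j ⋙ (φ.onPairs ⋙ X) ⋙ F) :=
  limit.pre (clamp.obj (φ.toFun j) ⋙ X ⋙ F) φ.functor ≫
    limMap (F := φ.functor ⋙ clamp.obj (φ.toFun j) ⋙ X ⋙ F)
      (G := clamp.obj j ⋙ (φ.onPairs ⋙ X) ⋙ F)
      (Functor.whiskerRight (clampIso φ j).hom (X ⋙ F))

theorem reindexApp_π (F : A ⥤ D) (X : Pairs ⥤ A) (φ : Bicofinal) (j i : ℤ) :
    reindexApp F X φ j ≫ limit.π (clamp.obj j ⋙ (φ.onPairs ⋙ X) ⋙ F) i =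
      limit.π (clamp.obj (φ.toFun j) ⋙ X ⋙ F) (φ.toFun i) ≫
        F.map (X.map ((clampIso φ j).hom.app i)) := by
  unfold reindexApp
  rw [Category.assoc, limMap_π, ← Category.assoc, limit.pre_π]
  rfl

theorem isIso_reindexApp (F : A ⥤ D) (X : Pairs ⥤ A) (φ : Bicofinal) (j : ℤ) :
    IsIso (reindexApp F X φ j) := by
  have := φ.initial_functor
  let e : φ.functor ⋙ clamp.obj (φ.toFun j) ⋙ X ⋙ F ≅ clamp.obj j ⋙ (φ.onPairs ⋙ X) ⋙ F :=
    Functor.isoWhiskerRight (clampIso φ j) (X ⋙ F)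
  have h1 : IsIso (limit.pre (clamp.obj (φ.toFun j) ⋙ X ⋙ F) φ.functor) := inferInstance
  have h2 : IsIso (limMap e.hom) := inferInstanceAs (IsIso (lim.map e.hom))
  exact IsIso.comp_isIso' h1 h2

theorem reindexApp_comp (F : A ⥤ D) (X : Pairs ⥤ A) {φ₀ φ₁ : Bicofinal} {j j' : ℤ}
    (a : clamp.obj (φ₀.toFun j) ⟶ clamp.obj (φ₁.toFun j'))
    (b : clamp.obj j ⋙ φ₀.onPairs ⟶ clamp.obj j' ⋙ φ₁.onPairs)
    (h : ∀ i, φ₀.toFun i ≤ φ₁.toFun i) :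
    limMap (Functor.whiskerRight a (X ⋙ F)) ≫ reindexApp F X φ₁ j' =
      reindexApp F X φ₀ j ≫ limMap (F := clamp.obj j ⋙ (φ₀.onPairs ⋙ X) ⋙ F)
        (G := clamp.obj j' ⋙ (φ₁.onPairs ⋙ X) ⋙ F) (Functor.whiskerRight b (X ⋙ F)) := by
  apply limit.hom_ext
  intro i
  have key : limit.π (clamp.obj (φ₀.toFun j) ⋙ X ⋙ F) (φ₁.toFun i) =
      limit.π (clamp.obj (φ₀.toFun j) ⋙ X ⋙ F) (φ₀.toFun i) ≫
        F.map (X.map ((clamp.obj (φ₀.toFun j)).map (homOfLE (h i)))) :=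
    (limit.w (clamp.obj (φ₀.toFun j) ⋙ X ⋙ F) (homOfLE (h i))).symm
  have e1 := (limMap (Functor.whiskerRight a (X ⋙ F))) ≫= reindexApp_π F X φ₁ j' i
  have e2 := reindexApp_π F X φ₀ j i =≫ F.map (X.map (b.app i))
  rw [limMap_π_assoc, key] at e1
  rw [Category.assoc, Category.assoc, limMap_π, e1]
  refine Eq.trans ?_ (e2.symm.trans (Category.assoc _ _ _))
  rw [Category.assoc, Category.assoc]
  congr 1
  exact map_comp_map_eq F X _ _ _ _ _

/-- The natural isomorphism `lim_i F X_{i, φ j} ≅ lim_i F X_{φ i, φ j}`. -/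
def reindex (F : A ⥤ D) (X : Pairs ⥤ A) (φ : Bicofinal) :
    φ.functor ⋙ (innerLim F).obj X ⟶ (innerLim F).obj (φ.onPairs ⋙ X) where
  app j := reindexApp F X φ j
  naturality _ _ f := reindexApp_comp F X (clamp.map (φ.functor.map f))
    (Functor.whiskerRight (clamp.map f) φ.onPairs) fun _ => le_refl _

theorem reindex_map (F : A ⥤ D) (X : Pairs ⥤ A) {φ₀ φ₁ : Bicofinal}
    (h : ∀ i, φ₀.toFun i ≤ φ₁.toFun i) :
    Functor.whiskerRight (Bicofinal.functorLE h) ((innerLim F).obj X) ≫ reindex F X φ₁ =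
      reindex F X φ₀ ≫
        (innerLim F).map (Functor.whiskerRight (Bicofinal.compare h) X) := by
  ext j
  exact reindexApp_comp F X (clamp.map ((Bicofinal.functorLE h).app j))
    (Functor.whiskerLeft (clamp.obj j) (Bicofinal.compare h)) h

theorem isIso_reindex (F : A ⥤ D) (X : Pairs ⥤ A) (φ : Bicofinal) : IsIso (reindex F X φ) := by
  have : ∀ j, IsIso ((reindex F X φ).app j) := fun j => isIso_reindexApp F X φ j
  exact NatIso.isIso_of_isIso_app _

theorem isIso_colimMap_functorLE (Z : ℤ ⥤ D') {φ₀ φ₁ : Bicofinal}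
    (h : ∀ i, φ₀.toFun i ≤ φ₁.toFun i) :
    IsIso (colim.map (Functor.whiskerRight (Bicofinal.functorLE h) Z)) := by
  have := φ₀.final_functor
  have := φ₁.final_functor
  have e : colim.map (Functor.whiskerRight (Bicofinal.functorLE h) Z) ≫
      colimit.pre Z φ₁.functor = colimit.pre Z φ₀.functor := by
    apply colimit.hom_ext
    intro j
    simp
  exact IsIso.of_isIso_fac_right e

theorem isIso_colimLim_compare (F : A ⥤ D) (G : D ⥤ D') (X : Pairs ⥤ A) {φ₀ φ₁ : Bicofinal}
    (h : ∀ i, φ₀.toFun i ≤ φ₁.toFun i) :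
    IsIso ((colimLim F G).map (Functor.whiskerRight (Bicofinal.compare h) X)) := by
  have e := congrArg (fun t => colim.map (Functor.whiskerRight t G)) (reindex_map F X h)
  simp only [Functor.whiskerRight_comp, Functor.map_comp] at e
  have h1 := isIso_colimMap_functorLE ((innerLim F).obj X ⋙ G) h
  have h2 : IsIso (colim.map (Functor.whiskerRight (Functor.whiskerRight
      (Bicofinal.functorLE h) ((innerLim F).obj X)) G)) := h1
  have h3 : ∀ φ, IsIso (colim.map (Functor.whiskerRight (reindex F X φ) G)) := fun φ => by
    have := isIso_reindex F X φ
    have : IsIso (Functor.whiskerRight (reindex F X φ) G) :=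
      inferInstanceAs (IsIso (((Functor.whiskeringRight ℤ D D').obj G).map (reindex F X φ)))
    exact inferInstance
  have h4 := h3 φ₀
  have h5 := h3 φ₁
  have h6 := IsIso.comp_isIso' h2 h5
  rw [e] at h6
  exact IsIso.of_isIso_comp_left (colim.map (Functor.whiskerRight (reindex F X φ₀) G)) (colim.map (Functor.whiskerRight
    ((innerLim F).map (Functor.whiskerRight (Bicofinal.compare h) X)) G))

end Limits

/-! ### The category of Tate spaces -/

variable (k : Type u) [Field k]

/-- A diagram `X` of finite-dimensional spaces on `Pairs` is admissible if
`0 → X_{i,j} → X_{i,l} → X_{j,l} → 0` is exact for all `i ≤ j ≤ l`. -/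
def IsAdmissible : ObjectProperty (Pairs ⥤ FGModuleCat.{u} k) := fun X =>
  ∀ (i j l : ℤ) (hij : i ≤ j) (hjl : j ≤ l),
    let f : X.obj (pair i j hij) ⟶ X.obj (pair i l (hij.trans hjl)) :=
      X.map (homOfLE ⟨le_refl i, hjl⟩)
    let g : X.obj (pair i l (hij.trans hjl)) ⟶ X.obj (pair j l hjl) :=
      X.map (homOfLE ⟨hij, le_refl l⟩)
    Function.Injective f ∧ Function.Exact f g ∧ Function.Surjective g

/-- The category of admissible diagrams of finite-dimensional spaces on `Pairs`. -/
abbrev AdmDiagram : Type (u + 1) := (IsAdmissible k).FullSubcategory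

variable {k}

/-- The reindexed diagram `X_{φ i, φ j}`. -/
def AdmDiagram.reindex (X : AdmDiagram k) (φ : Bicofinal) : AdmDiagram k :=
  ⟨φ.onPairs ⋙ X.obj, fun _ _ _ hij hjl => X.property _ _ _ (φ.mono hij) (φ.mono hjl)⟩

/-- For `φ₀ ≤ φ₁`, the morphism with components `X_{φ₀ i, φ₀ j} ⟶ X_{φ₁ i, φ₁ j}`. -/
def AdmDiagram.shift (X : AdmDiagram k) {φ₀ φ₁ : Bicofinal}
    (h : ∀ i, φ₀.toFun i ≤ φ₁.toFun i) : X.reindex φ₀ ⟶ X.reindex φ₁ :=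
  ObjectProperty.homMk (Functor.whiskerRight (Bicofinal.compare h) X.obj)

variable (k)

/-- The class of all morphisms `X_{φ₀ i, φ₀ j} ⟶ X_{φ₁ i, φ₁ j}`, for `X` an admissible diagram
and `φ₀ ≤ φ₁` bicofinal. -/
inductive shiftMaps : MorphismProperty (AdmDiagram k)
  | mk (X : AdmDiagram k) {φ₀ φ₁ : Bicofinal} (h : ∀ i, φ₀.toFun i ≤ φ₁.toFun i) :
      shiftMaps (X.shift h)

/-- The category of Tate spaces over `k`: the localization of the category of admissible
diagrams of finite-dimensional spaces at the class of morphisms `shiftMaps`. -/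
abbrev Tate : Type (u + 1) := (shiftMaps k).Localization

theorem shiftMaps_isInvertedBy {D : Type*} [Category* D] {D' : Type*} [Category* D']
    [HasLimitsOfShape ℤ D] [HasColimitsOfShape ℤ D'] (F : FGModuleCat.{u} k ⥤ D) (G : D ⥤ D') :
    (shiftMaps k).IsInvertedBy ((IsAdmissible k).ι ⋙ colimLim F G) := by
  rintro _ _ _ ⟨X, h⟩
  exact isIso_colimLim_compare F G X.obj h

/-! ### The exact structure on the category of Tate spaces -/

/-- The category of pro-objects of a category. -/
abbrev Pro (C : Type*) [Category* C] := (Ind Cᵒᵖ)ᵒᵖ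

/-- The category of ind-pro-objects in finite-dimensional vector spaces over `k`. -/
abbrev IndPro : Type (u + 1) := Ind (Pro (FGModuleCat.{u} k))

theorem hasColimitsOfShape_of_isFiltered {C : Type*} [Category.{u} C] (J : Type) [SmallCategory J]
    [IsFiltered J] : HasColimitsOfShape J (Ind C) := by
  have : IsFiltered (ULiftHom.{u} (ULift.{u} J)) :=
    IsFiltered.of_equivalence (ULiftHomULiftCategory.equiv.{u, u} J)
  exact hasColimitsOfShape_of_equivalence (ULiftHomULiftCategory.equiv.{u, u} J).symm

instance : HasColimitsOfShape ℤ (IndPro k) := hasColimitsOfShape_of_isFiltered ℤ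

instance : HasLimitsOfShape ℤ (Pro (FGModuleCat.{u} k)) :=
  have : HasColimitsOfShape ℤᵒᵖ (Ind (FGModuleCat.{u} k)ᵒᵖ) := hasColimitsOfShape_of_isFiltered ℤᵒᵖ
  hasLimitsOfShape_op_of_hasColimitsOfShape

/-- The functor `X ↦ "colim"_j "lim"_i X_{i,j}` from Tate spaces to ind-pro-objects. -/
def toIndPro : Tate k ⥤ IndPro k :=
  Localization.Construction.lift _
    (shiftMaps_isInvertedBy k (Ind.yoneda (C := (FGModuleCat.{u} k)ᵒᵖ)).rightOp Ind.yoneda)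

/-- In a category with a zero object, `i` is a kernel of `p` and `p` is a cokernel of `i`. In an
abelian category this says that `0 ⟶ X ⟶ Y ⟶ Z ⟶ 0` is a short exact sequence. -/
def IsKernelCokernelPair {C : Type*} [Category* C] {X Y Z : C} (i : X ⟶ Y) (p : Y ⟶ Z) : Prop :=
  ∃ (O : C) (_ : IsZero O) (s : X ⟶ O) (t : O ⟶ Z), IsPullback i s p t ∧ IsPushout i s p t

/-- The admissible short exact sequences of Tate spaces: those sequences which are short exact
in the abelian category of ind-pro-objects. -/
def Tate.IsAdmissibleExact {X Y Z : Tate k} (i : X ⟶ Y) (p : Y ⟶ Z) : Prop :=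
  IsKernelCokernelPair ((toIndPro k).map i) ((toIndPro k).map p)

/-! ### Locally linearly compact spaces -/

/-- A Hausdorff linearly topologized vector space is linearly compact if every family of closed
affine subspaces with the finite intersection property has nonempty intersection. -/
structure IsLinearlyCompact (V : Type*) [AddCommGroup V] [Module k V] [TopologicalSpace V] :
    Prop where
  isLinearTopology : IsLinearTopology k V
  t2Space : T2Space V
  nonempty_iInter : ∀ 𝓕 : Set (AffineSubspace k V), (∀ S ∈ 𝓕, IsClosed (S : Set V)) →
    (∀ t : Finset (AffineSubspace k V), (t : Set (AffineSubspace k V)) ⊆ 𝓕 →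
      (⋂ S ∈ t, (S : Set V)).Nonempty) → (⋂ S ∈ 𝓕, (S : Set V)).Nonempty

variable [TopologicalSpace k]

/-- A locally linearly compact space: a Hausdorff linearly topologized vector space with a linearly
compact open subspace. -/
structure IsLLC (V : TopModuleCat.{u} k) : Prop where
  isLinearTopology : IsLinearTopology k V
  t2Space : T2Space V
  exists_open : ∃ U : Submodule k V, IsOpen (U : Set V) ∧ IsLinearlyCompact k U

/-- A locally linearly compact space `V` is of countable type if `0` has a countable base of
neighbourhoods and `V / U` has countable dimension for some linearly compact open subspace `U`. -/
structure IsCountableLLC (V : TopModuleCat.{u} k) : Prop extends IsLLC k V where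
  countable_nhds : (nhds (0 : V)).IsCountablyGenerated
  countable_rank : ∃ U : Submodule k V, IsOpen (U : Set V) ∧ IsLinearlyCompact k U ∧
    Module.rank k (V ⧸ U) ≤ Cardinal.aleph0

/-- A vector space with the discrete topology, as a topological vector space over the discrete
field `k`. -/
def discrete [DiscreteTopology k] : FGModuleCat.{u} k ⥤ TopModuleCat.{u} k where
  obj V :=
    letI : TopologicalSpace V := ⊥
    haveI : DiscreteTopology V := ⟨rfl⟩
    haveI : ContinuousSMul k V := ⟨continuous_of_discreteTopology⟩
    TopModuleCat.of k V
  map {V W} f :=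
    letI : TopologicalSpace V := ⊥
    haveI : DiscreteTopology V := ⟨rfl⟩
    letI : TopologicalSpace W := ⊥
    haveI : DiscreteTopology W := ⟨rfl⟩
    haveI : ContinuousSMul k V := ⟨continuous_of_discreteTopology⟩
    haveI : ContinuousSMul k W := ⟨continuous_of_discreteTopology⟩
    TopModuleCat.ofHom ⟨f.hom.hom, continuous_of_discreteTopology⟩

instance : HasLimitsOfShape ℤ (TopModuleCat.{u} k) := inferInstance

/-- The functor `Φ` sending `X` to the topological vector space `colim_j lim_i X_{i,j}`, where the
`X_{i,j}` are discrete. -/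
def realization [DiscreteTopology k] : Tate k ⥤ TopModuleCat.{u} k :=
  Localization.Construction.lift _ (shiftMaps_isInvertedBy k (discrete k) (𝟭 _))

variable {k} [DiscreteTopology k]

/-- The admissible short exact sequences of locally linearly compact spaces: those isomorphic to
the image under `realization` of an admissible short exact sequence of Tate spaces. -/
def IsAdmissibleExact {V W Q : TopModuleCat.{u} k} (i : V ⟶ W) (p : W ⟶ Q) : Prop :=
  ∃ (X Y Z : Tate k) (i' : X ⟶ Y) (p' : Y ⟶ Z) (_ : Tate.IsAdmissibleExact k i' p')
    (eV : (realization k).obj X ≅ V) (eW : (realization k).obj Y ≅ W)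
    (eQ : (realization k).obj Z ≅ Q),
    (realization k).map i' ≫ eW.hom = eV.hom ≫ i ∧ (realization k).map p' ≫ eQ.hom = eW.hom ≫ p

/-- Admissible monomorphisms: the maps `i` in admissible short exact sequences
`0 ⟶ V ⟶ W ⟶ Q ⟶ 0`. -/
def IsAdmissibleMono {V W : TopModuleCat.{u} k} (i : V ⟶ W) : Prop :=
  ∃ (Q : TopModuleCat.{u} k) (p : W ⟶ Q), IsAdmissibleExact i p

/-- Admissible epimorphisms: the maps `p` in admissible short exact sequences
`0 ⟶ V ⟶ W ⟶ Q ⟶ 0`. -/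
def IsAdmissibleEpi {W Q : TopModuleCat.{u} k} (p : W ⟶ Q) : Prop :=
  ∃ (V : TopModuleCat.{u} k) (i : V ⟶ W), IsAdmissibleExact i p

/-- The canonical map `W / ker p → Q`. -/
def quotientKerMap {W Q : TopModuleCat.{u} k} (p : W ⟶ Q) :
    (W ⧸ LinearMap.ker p.hom.toLinearMap) →ₗ[k] Q :=
  (LinearMap.ker p.hom.toLinearMap).liftQ p.hom.toLinearMap le_rfl

end

end TateSpaces

/-!
A locally linearly compact space of countable type is a space `V` with a *lattice filtration*: an
exhaustive increasing sequence `F i`, `i ∈ ℤ`, of open submodules forming a base at `0`, with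
finite-dimensional subquotients, and with respect to which `V` is complete. The graded diagram
`(i, j) ↦ F j / F i` is admissible, and conversely the subspaces `lim_i X_{i,j}` form a lattice
filtration of `Φ(X)` with graded diagram `X`. Completeness makes a map of spaces respecting the
filtrations the same thing as a morphism of graded diagrams; an arbitrary continuous map respects
the filtrations after reindexing the target, and reindexings become invertible in `Tate k`. So `Φ`
is fully faithful, with the expected essential image.

The functor to ind-pro-objects is exact on diagrams. For a closed submodule `A` of `B` the
filtration of `B` induces filtrations of `A` and `B / A` with exact sequences of subquotients, so
`A ⟶ B ⟶ B / A` is admissible. For the converse it is enough to show that admissible sequences are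
exact on underlying vector spaces, because surjections in `𝓛` are open, by a Baire category argument
using that the image of a linearly compact subspace is closed. The points functor
`Hom(k, -)` on ind-pro-objects preserves finite limits and computes the underlying set of `Φ(X)`,
which gives injectivity and exactness in the middle. It does not obviously preserve cokernels;
instead one factors `p : Y ⟶ Z` through its coimage `Y ⟶ T` in `𝓛`. As `Z` is a cokernel, the map
`Y ⟶ T` descends in ind-pro-objects to a section of `T ⟶ Z`, so `T ⟶ Z` is surjective.
-/

namespace TateSpaces

noncomputable section

/-! ### Linearly topologized modules -/

section LinearTopology

variable {k : Type*} [Ring k] {U : Type*} [AddCommGroup U] [Module k U] [TopologicalSpace U]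

theorem isLinearTopology_of_basis {ι : Type*} {G : ι → Submodule k U}
    (isOpen : ∀ n, IsOpen (G n : Set U))
    (basis : ∀ N ∈ nhds (0 : U), ∃ n, (G n : Set U) ⊆ N) : IsLinearTopology k U :=
  IsLinearTopology.mk_of_hasBasis (p := fun _ : ι => True) k (s := G)
    ⟨fun N => ⟨fun hN => (basis N hN).imp fun _ hn => ⟨trivial, hn⟩, fun ⟨n, _, hn⟩ =>
      Filter.mem_of_superset ((isOpen n).mem_nhds (G n).zero_mem) hn⟩⟩

variable [IsTopologicalAddGroup U]

theorem t2Space_of_separated {ι : Type*} {G : ι → Submodule k U}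
    (isOpen : ∀ n, IsOpen (G n : Set U)) (separated : ∀ v, (∀ n, v ∈ G n) → v = 0) :
    T2Space U := by
  refine IsTopologicalAddGroup.t2Space_of_zero_sep fun x hx => ?_
  obtain ⟨n, hn⟩ : ∃ n, x ∉ G n := by
    by_contra! h
    exact hx (separated x h)
  exact ⟨G n, (isOpen n).mem_nhds (G n).zero_mem, hn⟩

theorem eq_zero_of_mem_open_submodules (k : Type*) [Ring k] [Module k U] [IsLinearTopology k U]
    [T2Space U] {v : U} (h : ∀ G : Submodule k U, IsOpen (G : Set U) → v ∈ G) : v = 0 := by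
  by_contra hv
  obtain ⟨G, hG, hGv⟩ := (IsLinearTopology.hasBasis_open_submodule k).mem_iff.1
    (isOpen_compl_singleton.mem_nhds (Ne.symm hv : (0 : U) ∈ ({v}ᶜ : Set U)))
  exact hGv (h G hG) rfl

theorem mem_of_isClosed_of_basis {ι : Type*} {G : ι → Submodule k U}
    (basis : ∀ N ∈ nhds (0 : U), ∃ n, (G n : Set U) ⊆ N) {S : Set U} (hS : IsClosed S) {v : U}
    (h : ∀ n, ∃ b ∈ S, b - v ∈ G n) : v ∈ S := by
  rw [← hS.closure_eq, mem_closure_iff_nhds]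
  intro N hN
  have hN₀ : (fun x => x + v) ⁻¹' N ∈ nhds (0 : U) :=
    (continuous_add_const v).continuousAt.preimage_mem_nhds (by rwa [zero_add])
  obtain ⟨n, hn⟩ := basis _ hN₀
  obtain ⟨b, hb, hbv⟩ := h n
  exact ⟨b, by simpa only [Set.mem_preimage, sub_add_cancel] using hn hbv, hb⟩

theorem isClosed_mk'_of_isOpen (x : U) {G : Submodule k U} (hG : IsOpen (G : Set U)) :
    IsClosed (AffineSubspace.mk' x G : Set U) := by
  have h : (AffineSubspace.mk' x G : Set U) = (fun v => v - x) ⁻¹' G := by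
    ext v
    rw [SetLike.mem_coe, AffineSubspace.mem_mk', vsub_eq_sub, Set.mem_preimage, SetLike.mem_coe]
  rw [h]
  exact (AddSubgroup.isClosed_of_isOpen G.toAddSubgroup hG).preimage
    (continuous_id.sub continuous_const)

theorem continuous_of_isOpen_le_ker {W : Type*} [AddCommGroup W] [Module k W] [TopologicalSpace W]
    [IsTopologicalAddGroup W] (f : U →ₗ[k] W) {G : Submodule k U} (hG : IsOpen (G : Set U))
    (h : G ≤ LinearMap.ker f) : Continuous f := by
  refine continuous_of_continuousAt_zero f fun N hN => Filter.mem_map.2 ?_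
  rw [map_zero] at hN
  refine Filter.mem_of_superset (hG.mem_nhds G.zero_mem) fun x hx => ?_
  rw [Set.mem_preimage, LinearMap.mem_ker.1 (h hx)]
  exact mem_of_mem_nhds hN

end LinearTopology

theorem exists_forall_approx {k U : Type*} [DivisionRing k] [AddCommGroup U] [Module k U]
    {𝓓 : Set (AffineSubspace k U)} (h𝓓 : 𝓓.Nonempty) (directed : DirectedOn (· ≥ ·) 𝓓)
    (nonempty : ∀ S ∈ 𝓓, (S : Set U).Nonempty) (G : Submodule k U)
    [Module.Finite k (U ⧸ G)] :
    ∃ S ∈ 𝓓, ∀ T ∈ 𝓓, ∀ a ∈ S, ∃ b ∈ T, b - a ∈ G := by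
  let dim (S : AffineSubspace k U) : ℕ := Module.finrank k (S.direction.map G.mkQ)
  refine ⟨Function.argminOn dim 𝓓 h𝓓, Function.argminOn_mem dim 𝓓 h𝓓, fun T hT a ha => ?_⟩
  set S := Function.argminOn dim 𝓓 h𝓓
  obtain ⟨R, hR, hRS, hRT⟩ := directed S (Function.argminOn_mem dim 𝓓 h𝓓) T hT
  have hdirection : R.direction.map G.mkQ = S.direction.map G.mkQ :=
    Submodule.eq_of_le_of_finrank_le (Submodule.map_mono (AffineSubspace.direction_le hRS))
      (Function.argminOn_le dim 𝓓 hR)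
  obtain ⟨c, hc⟩ := nonempty R hR
  obtain ⟨e, he, hea⟩ : G.mkQ (a - c) ∈ R.direction.map G.mkQ :=
    hdirection ▸ ⟨a - c, AffineSubspace.vsub_mem_direction ha (hRS hc), rfl⟩
  refine ⟨e + c, hRT (AffineSubspace.vadd_mem_of_mem_direction he hc), ?_⟩
  rw [add_sub_assoc, ← neg_sub a c, ← sub_eq_add_neg]
  exact (Submodule.Quotient.eq G).1 hea

section LinearlyCompact

variable {k : Type u} [Field k] {U : Type*} [AddCommGroup U] [Module k U] [TopologicalSpace U]

theorem IsLinearlyCompact.exists_forall_mem (hU : IsLinearlyCompact k U) {ι : Type*}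
    (S : ι → AffineSubspace k U) (hS : ∀ i, IsClosed (S i : Set U))
    (h : ∀ t : Finset ι, ∃ x, ∀ i ∈ t, x ∈ S i) : ∃ x, ∀ i, x ∈ S i := by
  classical
  obtain ⟨x, hx⟩ := hU.nonempty_iInter (Set.range S) (Set.forall_mem_range.2 hS) fun t ht => by
    rw [← Set.image_univ] at ht
    obtain ⟨t', -, rfl⟩ := Finset.subset_set_image_iff.1 ht
    obtain ⟨x, hx⟩ := h t'
    exact ⟨x, Set.mem_iInter₂.2 fun T hT => by
      obtain ⟨i, hi, rfl⟩ := Finset.mem_image.1 hT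
      exact hx i hi⟩
  exact ⟨x, fun i => Set.mem_iInter₂.1 hx _ ⟨i, rfl⟩⟩

variable [IsTopologicalAddGroup U]

theorem IsLinearlyCompact.exists_forall_sub_mem (hU : IsLinearlyCompact k U) {ι : Type*}
    (x : ι → U) (G : ι → Submodule k U) (hG : ∀ i, IsOpen (G i : Set U))
    (h : ∀ t : Finset ι, ∃ v, ∀ i ∈ t, v - x i ∈ G i) : ∃ v, ∀ i, v - x i ∈ G i := by
  simp only [← vsub_eq_sub, ← AffineSubspace.mem_mk'] at h ⊢
  exact hU.exists_forall_mem (fun i => AffineSubspace.mk' (x i) (G i))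
    (fun i => isClosed_mk'_of_isOpen (x i) (hG i)) h

theorem IsLinearlyCompact.exists_forall_sub_mem_of_directed (hU : IsLinearlyCompact k U)
    {ι : Type*} [Preorder ι] [IsCodirectedOrder ι] [Nonempty ι] (x : ι → U)
    (G : ι → Submodule k U) (hG : ∀ i, IsOpen (G i : Set U))
    (hx : ∀ i j, i ≤ j → x i - x j ∈ G j) : ∃ v, ∀ i, v - x i ∈ G i :=
  hU.exists_forall_sub_mem x G hG fun t => by
    obtain ⟨m, hm⟩ := t.finite_toSet.bddBelow
    exact ⟨x m, fun i hi => hx m i (hm hi)⟩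

theorem IsLinearlyCompact.finite_quotient (hU : IsLinearlyCompact k U) {G : Submodule k U}
    (hG : IsOpen (G : Set U)) : Module.Finite k (U ⧸ G) := by
  classical
  -- Finitely many coordinates of a vector of `U ⧸ G` may be prescribed to be `1`, so by linear
  -- compactness all of them may.
  let b := Module.Basis.ofVectorSpace k (U ⧸ G)
  let coord : _ → U →ₗ[k] k := fun i => b.coord i ∘ₗ G.mkQ
  choose x hx using fun i => G.mkQ_surjective (b i)
  have coord_x (i j) : coord i (x j) = if j = i then 1 else 0 := by
    rw [LinearMap.comp_apply, hx, b.coord_apply, b.repr_self_apply]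
  obtain ⟨v, hv⟩ := hU.exists_forall_sub_mem x (fun i => LinearMap.ker (coord i))
    (fun i => Submodule.isOpen_mono (U := G) (fun y hy => by
      rw [LinearMap.mem_ker, LinearMap.comp_apply, (G.mkQ_apply y).trans
        ((Submodule.Quotient.mk_eq_zero G).2 hy), map_zero]) hG)
    fun t => ⟨∑ j ∈ t, x j, fun i hi => by
      simp [map_sum, coord_x, hi]⟩
  have hone (i) : b.repr (G.mkQ v) i = 1 := by
    have h := hv i
    rwa [LinearMap.mem_ker, map_sub, coord_x, if_pos rfl, sub_eq_zero] at h
  have : Finite (Module.Basis.ofVectorSpaceIndex k (U ⧸ G)) :=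
    Set.finite_univ_iff.1 ((b.repr (G.mkQ v)).support.finite_toSet.subset fun i _ =>
      Finset.mem_coe.2 (Finsupp.mem_support_iff.2 ((hone i).trans_ne one_ne_zero)))
  exact Module.Finite.of_basis b

theorem IsLinearlyCompact.isClosed_range (hU : IsLinearlyCompact k U) {W : Type*} [AddCommGroup W]
    [Module k W] [TopologicalSpace W] [IsTopologicalAddGroup W] [IsLinearTopology k W] [T2Space W]
    (f : U →ₗ[k] W) (hf : Continuous f) : IsClosed (Set.range f) := by
  classical
  refine isClosed_of_closure_subset fun y hy => ?_
  have approx (G : Submodule k W) (hG : IsOpen (G : Set W)) : ∃ x, f x - y ∈ G := by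
    obtain ⟨_, h, x, rfl⟩ := mem_closure_iff.1 hy _ (hG.preimage (continuous_sub_right y))
      (by simp)
    exact ⟨x, h⟩
  let ι := {G : Submodule k W // IsOpen (G : Set W)}
  choose x hx using fun G : ι => approx G.1 G.2
  obtain ⟨v, hv⟩ := hU.exists_forall_sub_mem x (fun G => G.1.comap f)
    (fun G => G.2.preimage hf) fun t => by
      obtain ⟨v, hv⟩ := approx (t.inf fun G => G.1)
        (Finset.inf_induction (p := fun H : Submodule k W => IsOpen (H : Set W)) isOpen_univ
          (fun _ hG _ hH => hG.inter hH) fun G _ => G.2)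
      refine ⟨v, fun G hG => ?_⟩
      have h := G.1.sub_mem (Finset.inf_le (f := fun G : ι => G.1) hG hv) (hx G)
      rwa [sub_sub_sub_cancel_right, ← map_sub] at h
  refine ⟨v, sub_eq_zero.1 (eq_zero_of_mem_open_submodules k fun G hG => ?_)⟩
  have h := G.add_mem (hv ⟨G, hG⟩) (hx ⟨G, hG⟩)
  rwa [map_sub, sub_add_sub_cancel] at h

theorem exists_mem_closed_of_directedOn {G : ℕ → Submodule k U}
    (basis : ∀ N ∈ nhds (0 : U), ∃ n, (G n : Set U) ⊆ N)
    (finite : ∀ n, Module.Finite k (U ⧸ G n))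
    (complete : ∀ x : ℕ → U, (∀ n, x (n + 1) - x n ∈ G n) → ∃ v, ∀ n, v - x n ∈ G n)
    {𝓓 : Set (AffineSubspace k U)} (h𝓓 : 𝓓.Nonempty) (directed : DirectedOn (· ≥ ·) 𝓓)
    (nonempty : ∀ S ∈ 𝓓, (S : Set U).Nonempty) :
    ∃ v, ∀ S ∈ 𝓓, IsClosed (S : Set U) → v ∈ S := by
  choose S hS approx using fun n => exists_forall_approx h𝓓 directed nonempty (G n)
  choose! next next_mem next_sub using fun n a ha => approx n (S (n + 1)) (hS (n + 1)) a ha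
  obtain ⟨x₀, hx₀⟩ := nonempty (S 0) (hS 0)
  let x (n : ℕ) : U := Nat.rec x₀ next n
  have hx (n : ℕ) : x n ∈ S n := by
    induction n with
    | zero => exact hx₀
    | succ n ih => exact next_mem n _ ih
  obtain ⟨v, hv⟩ := complete x fun n => next_sub n _ (hx n)
  refine ⟨v, fun T hT hclosed => mem_of_isClosed_of_basis basis hclosed fun n => ?_⟩
  obtain ⟨b, hb, hbx⟩ := approx n T hT (x n) (hx n)
  exact ⟨b, hb, by simpa only [sub_sub_sub_cancel_right] using (G n).sub_mem hbx (hv n)⟩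

theorem isLinearlyCompact_of_basis {G : ℕ → Submodule k U} (isOpen : ∀ n, IsOpen (G n : Set U))
    (basis : ∀ N ∈ nhds (0 : U), ∃ n, (G n : Set U) ⊆ N)
    (separated : ∀ v, (∀ n, v ∈ G n) → v = 0)
    (finite : ∀ n, Module.Finite k (U ⧸ G n))
    (complete : ∀ x : ℕ → U, (∀ n, x (n + 1) - x n ∈ G n) → ∃ v, ∀ n, v - x n ∈ G n) :
    IsLinearlyCompact k U where
  isLinearTopology := isLinearTopology_of_basis isOpen basis
  t2Space := t2Space_of_separated isOpen separated
  nonempty_iInter 𝓕 hclosed hfip := by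
    classical
    let 𝓓 : Set (AffineSubspace k U) :=
      (fun t : Finset (AffineSubspace k U) => sInf (t : Set _)) '' {t | (t : Set _) ⊆ 𝓕}
    obtain ⟨v, hv⟩ := exists_mem_closed_of_directedOn (𝓓 := 𝓓) basis finite complete
      ⟨_, ∅, by simp, rfl⟩
      (by
        rintro _ ⟨s, hs, rfl⟩ _ ⟨t, ht, rfl⟩
        exact ⟨_, ⟨s ∪ t, by simpa using ⟨hs, ht⟩, rfl⟩, sInf_le_sInf (by simp),
          sInf_le_sInf (by simp)⟩)
      (by
        rintro _ ⟨t, ht, rfl⟩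
        simpa only [AffineSubspace.coe_sInf, Finset.mem_coe] using hfip t ht)
    exact ⟨v, Set.mem_iInter₂.2 fun T hT => hv T ⟨{T}, by simpa using hT, by simp⟩ (hclosed T hT)⟩

end LinearlyCompact

/-! ### Lattice filtrations -/

theorem fg_map_mkQ_iff {k V : Type*} [Ring k] [AddCommGroup V] [Module k V]
    (P Q : Submodule k V) : (P.map Q.mkQ).FG ↔ Module.Finite k (P ⧸ Q.submoduleOf P) := by
  have hker : LinearMap.ker (Q.mkQ ∘ₗ P.subtype) = Q.submoduleOf P := by
    rw [LinearMap.ker_comp, Submodule.ker_mkQ]; rfl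
  have hrange : LinearMap.range (Q.mkQ ∘ₗ P.subtype) = P.map Q.mkQ := by
    rw [LinearMap.range_comp, Submodule.range_subtype]
  rw [← Module.Finite.iff_fg, ← hker, ← hrange]
  exact (Module.Finite.equiv_iff (LinearMap.quotKerEquivRange _)).symm

theorem fg_map_map_mkQ {k V W : Type*} [Ring k] [AddCommGroup V] [Module k V] [AddCommGroup W]
    [Module k W] {P Q : Submodule k V} (h : (P.map Q.mkQ).FG) (f : V →ₗ[k] W) :
    ((P.map f).map (Q.map f).mkQ).FG := by
  convert h.map (Submodule.mapQ Q (Q.map f) f (Submodule.le_comap_map _ _)) using 1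
  rw [← Submodule.map_comp, ← Submodule.map_comp, Submodule.mapQ_mkQ]

theorem sub_mem_of_succ {k V : Type*} [Ring k] [AddCommGroup V] [Module k V]
    {G : ℕ → Submodule k V} (hG : Antitone G) {x : ℕ → V} (hx : ∀ n, x (n + 1) - x n ∈ G n)
    {n m : ℕ} (h : n ≤ m) : x m - x n ∈ G n := by
  induction m, h using Nat.le_induction with
  | base => simp
  | succ m h ih => simpa only [sub_add_sub_cancel] using (G n).add_mem (hG h (hx m)) ih

/-- A filtration of a topological module by lattices: an increasing exhaustive family of open
submodules, forming a base of neighbourhoods of `0` with trivial intersection, whose subquotients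
`F j / F i` are finitely generated and for which the module is complete. Over a discrete field, the
spaces admitting one are the locally linearly compact spaces of countable type, see
`exists_isLatticeFiltration_iff`. -/
structure IsLatticeFiltration {k V : Type*} [Ring k] [AddCommGroup V] [Module k V]
    [TopologicalSpace V] (F : ℤ → Submodule k V) : Prop where
  mono : Monotone F
  isOpen : ∀ i, IsOpen (F i : Set V)
  basis : ∀ N ∈ nhds (0 : V), ∃ i, (F i : Set V) ⊆ N
  exhaust : ∀ v, ∃ j, v ∈ F j
  separated : ∀ v, (∀ i, v ∈ F i) → v = 0
  finite : ∀ i j, ((F j).map (F i).mkQ).FG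
  complete : ∀ x : ℤ → V, (∀ i j, i ≤ j → x i - x j ∈ F j) → ∃ v, ∀ i, v - x i ∈ F i

theorem complete_iff_nat {k V : Type*} [Ring k] [AddCommGroup V] [Module k V]
    {F : ℤ → Submodule k V} (hF : Monotone F) :
    (∀ x : ℤ → V, (∀ i j, i ≤ j → x i - x j ∈ F j) → ∃ v, ∀ i, v - x i ∈ F i) ↔
      ∀ x : ℕ → V, (∀ n : ℕ, x (n + 1) - x n ∈ F (-n)) → ∃ v, ∀ n : ℕ, v - x n ∈ F (-n) := by
  constructor
  · intro complete x hx
    have hsub {n m : ℕ} (h : n ≤ m) : x m - x n ∈ F (-n) :=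
      sub_mem_of_succ (G := fun n : ℕ => F (-n)) (fun a b h => hF (by simpa using h)) hx h
    obtain ⟨v, hv⟩ := complete (fun i => x (-i).toNat) fun i j hij =>
      hF (by omega) (hsub (by omega))
    exact ⟨v, fun n => by simpa using hv (-n)⟩
  · intro complete x hx
    obtain ⟨v, hv⟩ := complete (fun n => x (-n)) fun n => hx (-(n + 1 : ℕ)) (-n) (by omega)
    refine ⟨v, fun i => ?_⟩
    have hle : -((-i).toNat : ℤ) ≤ i := by omega
    simpa only [sub_add_sub_cancel] using (F i).add_mem (hF hle (hv (-i).toNat)) (hx _ _ hle)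

namespace IsLatticeFiltration

section Basic

variable {k V : Type*} [Ring k] [AddCommGroup V] [Module k V] [TopologicalSpace V]
  {F : ℤ → Submodule k V}

theorem complete_nat (hF : IsLatticeFiltration F) (x : ℕ → V)
    (hx : ∀ n : ℕ, x (n + 1) - x n ∈ F (-n)) : ∃ v, ∀ n : ℕ, v - x n ∈ F (-n) :=
  (complete_iff_nat hF.mono).1 hF.complete x hx

theorem basis_nat (hF : IsLatticeFiltration F) (N : Set V) (hN : N ∈ nhds (0 : V)) :
    ∃ n : ℕ, (F (-n) : Set V) ⊆ N := by
  obtain ⟨i, hi⟩ := hF.basis N hN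
  exact ⟨(-i).toNat, fun v hv => hi (hF.mono (by omega) hv)⟩

theorem separated_nat (hF : IsLatticeFiltration F) (v : V) (hv : ∀ n : ℕ, v ∈ F (-n)) : v = 0 :=
  hF.separated v fun i => hF.mono (by omega) (hv (-i).toNat)

theorem exhaust_nat (hF : IsLatticeFiltration F) (v : V) : ∃ n : ℕ, v ∈ F n := by
  obtain ⟨j, hj⟩ := hF.exhaust v
  exact ⟨j.toNat, hF.mono (by omega) hj⟩

theorem isLinearTopology (hF : IsLatticeFiltration F) : IsLinearTopology k V :=
  isLinearTopology_of_basis hF.isOpen hF.basis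

theorem t2Space [IsTopologicalAddGroup V] (hF : IsLatticeFiltration F) : T2Space V :=
  t2Space_of_separated hF.isOpen hF.separated

theorem countable_nhds (hF : IsLatticeFiltration F) : (nhds (0 : V)).IsCountablyGenerated := by
  have hbasis : (nhds (0 : V)).HasBasis (fun _ : ℤ => True) fun i => (F i : Set V) :=
    ⟨fun N => ⟨fun hN => (hF.basis N hN).imp fun _ hi => ⟨trivial, hi⟩, fun ⟨i, _, hi⟩ =>
      Filter.mem_of_superset ((hF.isOpen i).mem_nhds (F i).zero_mem) hi⟩⟩
  exact Filter.HasCountableBasis.isCountablyGenerated ⟨hbasis, Set.to_countable _⟩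

theorem rank_quotient_le [StrongRankCondition k] (hF : IsLatticeFiltration F) :
    Module.rank k (V ⧸ F 0) ≤ Cardinal.aleph0 := by
  choose S hS using fun n : ℕ => Submodule.fg_def.1 (hF.finite 0 n)
  have hspan : Submodule.span k (⋃ n, S n) = ⊤ := by
    refine eq_top_iff.2 fun x _ => ?_
    obtain ⟨v, rfl⟩ := (F 0).mkQ_surjective x
    obtain ⟨n, hn⟩ := hF.exhaust_nat v
    refine Submodule.span_mono (Set.subset_iUnion S n) ?_
    rw [(hS n).2]
    exact ⟨v, hn, rfl⟩
  rw [← rank_top, ← hspan]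
  exact (rank_span_le _).trans
    (Cardinal.le_aleph0_iff_set_countable.2 (Set.countable_iUnion fun n => (hS n).1.countable))

theorem comp_bicofinal (hF : IsLatticeFiltration F) (φ : Bicofinal) :
    IsLatticeFiltration fun j => F (φ.toFun j) where
  mono := hF.mono.comp φ.mono
  isOpen i := hF.isOpen _
  basis N hN := by
    obtain ⟨i, hi⟩ := hF.basis N hN
    obtain ⟨j, hj⟩ := (φ.tendsto_atBot.eventually_le_atBot i).exists
    exact ⟨j, fun v hv => hi (hF.mono hj hv)⟩
  exhaust v := by
    obtain ⟨i, hi⟩ := hF.exhaust v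
    obtain ⟨j, hj⟩ := (φ.tendsto_atTop.eventually_ge_atTop i).exists
    exact ⟨j, hF.mono hj hi⟩
  separated v hv := hF.separated v fun i => by
    obtain ⟨j, hj⟩ := (φ.tendsto_atBot.eventually_le_atBot i).exists
    exact hF.mono hj (hv j)
  finite i j := hF.finite _ _
  complete x hx := by
    have hsub (i j) : x i - x j ∈ F (max (φ.toFun i) (φ.toFun j)) := by
      rw [← φ.mono.map_max]
      rcases le_total i j with h | h
      · rw [max_eq_right h]; exact hx i j h
      · rw [max_eq_left h, ← neg_mem_iff, neg_sub]; exact hx j i h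
    choose b hb using fun i => (φ.tendsto_atBot.eventually_le_atBot i).exists
    obtain ⟨v, hv⟩ := hF.complete (fun i => x (b i)) fun i j hij =>
      hF.mono (max_le ((hb i).trans hij) (hb j)) (hsub (b i) (b j))
    refine ⟨v, fun j => ?_⟩
    simpa only [sub_add_sub_cancel] using (F (φ.toFun j)).add_mem (hv (φ.toFun j))
      (hF.mono (max_le (hb _) le_rfl) (hsub (b (φ.toFun j)) j))

end Basic

section SubspacesAndQuotients

variable {k V W : Type*} [Ring k] [AddCommGroup V] [Module k V] [TopologicalSpace V]
  [IsTopologicalAddGroup V] [AddCommGroup W] [Module k W] [TopologicalSpace W]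
  {F : ℤ → Submodule k V}

theorem comap [IsNoetherianRing k] (hF : IsLatticeFiltration F) (i : W →ₗ[k] V)
    (hi : Topology.IsClosedEmbedding i) :
    IsLatticeFiltration fun j => (F j).comap i where
  mono _ _ h := Submodule.comap_mono (hF.mono h)
  isOpen j := (hF.isOpen j).preimage hi.continuous
  basis N hN := by
    rw [hi.isInducing.nhds_eq_comap, map_zero] at hN
    obtain ⟨N', hN', h⟩ := hN
    obtain ⟨j, hj⟩ := hF.basis N' hN'
    exact ⟨j, fun v hv => h (hj hv)⟩
  exhaust v := hF.exhaust (i v)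
  separated v hv := hi.injective ((hF.separated _ hv).trans (map_zero i).symm)
  finite a b := by
    let f : W ⧸ (F a).comap i →ₗ[k] V ⧸ F a := Submodule.mapQ _ _ i le_rfl
    have hf : LinearMap.ker f = ⊥ := by
      rw [Submodule.ker_mapQ, Submodule.mkQ_map_self]
    refine Submodule.fg_of_fg_map f hf (Submodule.FG.of_le (hF.finite a b) ?_)
    rw [← Submodule.map_comp, Submodule.mapQ_mkQ, Submodule.map_comp]
    exact Submodule.map_mono (Submodule.map_comap_le _ _)
  complete x hx := by
    obtain ⟨v, hv⟩ := hF.complete (fun n => i (x n)) fun a b h => by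
      simpa only [Submodule.mem_comap, map_sub] using hx a b h
    obtain ⟨w, rfl⟩ : v ∈ Set.range i :=
      mem_of_isClosed_of_basis hF.basis hi.isClosed_range fun n =>
        ⟨i (x n), ⟨_, rfl⟩, by simpa only [neg_sub] using (F n).neg_mem (hv n)⟩
    exact ⟨w, fun n => by simpa using hv n⟩

theorem map (hF : IsLatticeFiltration F) (p : V →ₗ[k] W) (hp : IsOpenQuotientMap p)
    (hK : IsClosed (LinearMap.ker p : Set V)) : IsLatticeFiltration fun j => (F j).map p where
  mono _ _ h := Submodule.map_mono (hF.mono h)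
  isOpen j := hp.isOpenMap _ (hF.isOpen j)
  basis N hN := by
    obtain ⟨j, hj⟩ := hF.basis (p ⁻¹' N)
      (hp.continuous.continuousAt.preimage_mem_nhds (by rwa [map_zero]))
    exact ⟨j, by rintro _ ⟨v, hv, rfl⟩; exact hj hv⟩
  exhaust w := by
    obtain ⟨v, rfl⟩ := hp.surjective w
    exact (hF.exhaust v).imp fun j hj => ⟨v, hj, rfl⟩
  separated w hw := by
    obtain ⟨v, rfl⟩ := hp.surjective w
    refine mem_of_isClosed_of_basis hF.basis hK fun n => ?_
    obtain ⟨x, hx, hxv⟩ := hw n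
    refine ⟨v - x, ?_, by simpa using hx⟩
    rw [SetLike.mem_coe, LinearMap.mem_ker, map_sub, hxv, sub_self]
  finite a b := fg_map_map_mkQ (hF.finite a b) p
  complete := by
    refine (complete_iff_nat fun _ _ h => Submodule.map_mono (hF.mono h)).2 fun y hy => ?_
    choose d hd hdy using hy
    obtain ⟨x₀, hx₀⟩ := hp.surjective (y 0)
    let x (n : ℕ) : V := x₀ + ∑ m ∈ Finset.range n, d m
    have hx (n) : p (x n) = y n := by
      simp only [x, map_add, map_sum, hx₀, hdy, Finset.sum_range_sub, add_sub_cancel]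
    obtain ⟨v, hv⟩ := hF.complete_nat x fun n => by
      simpa only [x, Finset.sum_range_succ, add_sub_add_left_eq_sub, add_sub_cancel_left,
        SetLike.mem_coe] using hd n
    exact ⟨p v, fun n => ⟨v - x n, hv n, by rw [map_sub, hx]⟩⟩

end SubspacesAndQuotients

end IsLatticeFiltration

/-! ### Countable type and the open mapping theorem -/

section LinearlyCompactSteps

variable {k : Type u} [Field k] {V : Type*} [AddCommGroup V] [Module k V] [TopologicalSpace V]
  [IsTopologicalAddGroup V] {F : ℤ → Submodule k V}

theorem IsLatticeFiltration.isLinearlyCompact_of_eq_top (hF : IsLatticeFiltration F) {j : ℤ}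
    (hj : F j = ⊤) : IsLinearlyCompact k V :=
  isLinearlyCompact_of_basis (fun n : ℕ => hF.isOpen (-n)) hF.basis_nat hF.separated_nat
    (fun n => Module.finite_def.2 <| by
      simpa only [hj, Submodule.map_top, Submodule.range_mkQ] using hF.finite (-n) j)
    hF.complete_nat

theorem IsLatticeFiltration.isLinearlyCompact (hF : IsLatticeFiltration F) (j : ℤ) :
    IsLinearlyCompact k (F j) :=
  (hF.comap (F j).subtype
    (AddSubgroup.isClosed_of_isOpen (F j).toAddSubgroup (hF.isOpen j)).isClosedEmbedding_subtypeVal)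
    |>.isLinearlyCompact_of_eq_top (j := j) (Submodule.comap_subtype_self _)

end LinearlyCompactSteps

theorem IsLatticeFiltration.isCountableLLC {k : Type u} [Field k] [TopologicalSpace k]
    {V : TopModuleCat.{u} k} {F : ℤ → Submodule k V} (hF : IsLatticeFiltration F) :
    IsCountableLLC k V where
  isLinearTopology := hF.isLinearTopology
  t2Space := hF.t2Space
  exists_open := ⟨F 0, hF.isOpen 0, hF.isLinearlyCompact 0⟩
  countable_nhds := hF.countable_nhds
  countable_rank := ⟨F 0, hF.isOpen 0, hF.isLinearlyCompact 0, hF.rank_quotient_le⟩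

section ExistsFiltration

theorem exists_monotone_fg_of_rank_le {k V : Type*} [DivisionRing k] [AddCommGroup V] [Module k V]
    (U : Submodule k V) (hU : Module.rank k (V ⧸ U) ≤ Cardinal.aleph0) :
    ∃ T : ℕ → Submodule k V, Monotone T ∧ T 0 = ⊥ ∧ (∀ n, (T n).FG) ∧ ∀ v, ∃ n, v ∈ U ⊔ T n := by
  let b := Module.Basis.ofVectorSpace k (V ⧸ U)
  rw [← b.mk_eq_rank'', Cardinal.mk_le_aleph0_iff] at hU
  obtain ⟨e, he⟩ := ((Set.countable_range b).insert 0).exists_eq_range (Set.insert_nonempty _ _)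
  choose w hw using fun n => U.mkQ_surjective (e n)
  let T (n : ℕ) : Submodule k V := Submodule.span k (w '' Set.Iio n)
  have hT : Monotone T := fun _ _ h => Submodule.span_mono (Set.image_mono (Set.Iio_subset_Iio h))
  refine ⟨T, hT, by simp [T], fun n => Submodule.fg_span ((Set.finite_Iio n).image w), fun v => ?_⟩
  have hmap : (⨆ n, T n).map U.mkQ = ⊤ := by
    rw [eq_top_iff, ← b.span_eq, Submodule.span_le]
    rintro _ ⟨i, rfl⟩
    obtain ⟨n, hn⟩ := he.le (Set.mem_insert_of_mem 0 ⟨i, rfl⟩)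
    exact ⟨w n, Submodule.mem_iSup_of_mem (n + 1) (Submodule.subset_span ⟨n, n.lt_succ_self, rfl⟩),
      (hw n).trans hn⟩
  rw [Submodule.map_mkQ_eq_top, sup_iSup, eq_top_iff] at hmap
  have hdirected : Directed (· ≤ ·) fun n => U ⊔ T n :=
    Monotone.directed_le fun _ _ h => sup_le_sup_left (hT h) U
  exact (Submodule.mem_iSup_of_directed _ hdirected).1 (hmap Submodule.mem_top)

variable {k : Type u} [Field k] {V : Type*} [AddCommGroup V] [Module k V] [TopologicalSpace V]
  [IsTopologicalAddGroup V] [IsLinearTopology k V]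

theorem exists_antitone_isOpen_basis (hV : (nhds (0 : V)).IsCountablyGenerated)
    {U : Submodule k V} (hU : IsOpen (U : Set V)) :
    ∃ N : ℕ → Submodule k V, Antitone N ∧ N 0 = U ∧ (∀ n, IsOpen (N n : Set V)) ∧
      ∀ S ∈ nhds (0 : V), ∃ n, (N n : Set V) ⊆ S := by
  obtain ⟨N, hN, hbasis⟩ :=
    (IsLinearTopology.hasBasis_open_submodule k (M := V)).exists_antitone_subbasis
  refine ⟨fun n => n.casesOn U fun m => U ⊓ N m, antitone_nat_of_succ_le fun n => ?_, rfl,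
    fun n => ?_, fun S hS => ?_⟩
  · cases n with
    | zero => exact inf_le_left
    | succ n => exact inf_le_inf_left U (hbasis.antitone n.le_succ)
  · cases n with
    | zero => exact hU
    | succ n => exact hU.inter (hN n)
  · obtain ⟨n, hn⟩ := hbasis.mem_iff.1 hS
    exact ⟨n + 1, fun v hv => hn hv.2⟩

variable [T2Space V]

theorem exists_isLatticeFiltration_of_isLinearlyCompact
    (hV : (nhds (0 : V)).IsCountablyGenerated) {U : Submodule k V} (hU : IsOpen (U : Set V))
    (hcompact : IsLinearlyCompact k U) (hrank : Module.rank k (V ⧸ U) ≤ Cardinal.aleph0) :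
    ∃ F : ℤ → Submodule k V, IsLatticeFiltration F := by
  obtain ⟨N, hN, hN₀, hNopen, hNbasis⟩ := exists_antitone_isOpen_basis hV hU
  obtain ⟨T, hT, hT₀, hTfg, hTexhaust⟩ := exists_monotone_fg_of_rank_le U hrank
  let F (j : ℤ) : Submodule k V := N (-j).toNat ⊔ T j.toNat
  have hmono : Monotone F := fun i j h => sup_le_sup (hN (by omega)) (hT (by omega))
  have hopen (j) : IsOpen (F j : Set V) := Submodule.isOpen_mono le_sup_left (hNopen _)
  have hF₀ : F 0 = U := by simp [F, hN₀, hT₀]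
  have hbasis (S) (hS : S ∈ nhds (0 : V)) : ∃ i, (F i : Set V) ⊆ S := by
    obtain ⟨n, hn⟩ := hNbasis S hS
    exact ⟨-n, by simpa [F, hT₀] using hn⟩
  have hopen_sub (i) : IsOpen ((F i).submoduleOf U : Set U) :=
    (hopen i).preimage continuous_subtype_val
  refine ⟨F, hmono, hopen, hbasis, fun v => ?_, fun v hv => ?_, fun i j => ?_, fun x hx => ?_⟩
  · obtain ⟨n, hn⟩ := hTexhaust v
    exact ⟨n, by simpa [F, hN₀] using hn⟩
  · refine eq_zero_of_mem_open_submodules k fun G hG => ?_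
    obtain ⟨i, hi⟩ := hbasis G (hG.mem_nhds G.zero_mem)
    exact hi (hv i)
  · have hfinite := hcompact.finite_quotient (hopen_sub i)
    refine Submodule.FG.of_le (((fg_map_mkQ_iff U (F i)).2 hfinite).sup
      ((hTfg j.toNat).map (F i).mkQ)) ?_
    rw [← Submodule.map_sup]
    exact Submodule.map_mono (sup_le_sup_right (hN₀ ▸ hN (Nat.zero_le _)) _)
  · have hsub (i j : ℤ) (h : i ≤ j) : x (min i 0) - x (min j 0) ∈ F (min j 0) :=
      hx _ _ (min_le_min_right 0 h)
    let y (i : ℤ) : U := ⟨x (min i 0) - x 0, hF₀ ▸ hx _ _ (min_le_right i 0)⟩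
    obtain ⟨v, hv⟩ := hcompact.exists_forall_sub_mem_of_directed y _ hopen_sub fun i j h => by
      change x (min i 0) - x 0 - (x (min j 0) - x 0) ∈ F j
      rw [sub_sub_sub_cancel_right]
      exact hmono (min_le_left j 0) (hsub i j h)
    refine ⟨v + x 0, fun i => ?_⟩
    have h : (v : V) - (x (min i 0) - x 0) + (x (min i 0) - x i) ∈ F i :=
      (F i).add_mem (hv i) (hx _ _ (min_le_left i 0))
    rwa [← add_sub_assoc, ← sub_add, sub_add_eq_add_sub, sub_add_cancel] at h

end ExistsFiltration

theorem exists_isLatticeFiltration_iff {k : Type u} [Field k] [TopologicalSpace k]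
    (V : TopModuleCat.{u} k) :
    IsCountableLLC k V ↔ ∃ F : ℤ → Submodule k V, IsLatticeFiltration F := by
  refine ⟨fun h => ?_, fun ⟨F, hF⟩ => hF.isCountableLLC⟩
  have := h.isLinearTopology
  have := h.t2Space
  obtain ⟨U, hU, hcompact, hrank⟩ := h.countable_rank
  exact exists_isLatticeFiltration_of_isLinearlyCompact h.countable_nhds hU hcompact hrank

section OpenMapping

theorem isOpen_of_isClosed_of_fg {k V : Type*} [Field k] [AddCommGroup V] [Module k V]
    [TopologicalSpace V] [IsTopologicalAddGroup V] [IsLinearTopology k V] {C D : Submodule k V}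
    (hC : IsClosed (C : Set V)) (hD : IsOpen (D : Set V)) (h : (D.map C.mkQ).FG) :
    IsOpen (C : Set V) := by
  let 𝓓 : Set (Submodule k V) := {G | IsOpen (G : Set V) ∧ G ≤ D}
  let dim (G : Submodule k V) : ℕ := Module.finrank k (G.map C.mkQ)
  obtain ⟨G, ⟨hG, hGD⟩, hmin⟩ : ∃ G ∈ 𝓓, ∀ H ∈ 𝓓, dim G ≤ dim H :=
    ⟨Function.argminOn dim 𝓓 ⟨D, hD, le_rfl⟩, Function.argminOn_mem _ _ _,
      fun _ => Function.argminOn_le dim 𝓓⟩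
  have := Module.Finite.iff_fg.2 (h.of_le (Submodule.map_mono hGD))
  refine Submodule.isOpen_mono (fun v hv => ?_) hG
  refine mem_of_isClosed_of_basis (G := fun H : {H : Submodule k V // IsOpen (H : Set V)} => H.1)
    (fun N hN => ?_) hC fun H => ?_
  · obtain ⟨H, hH, hHN⟩ := (IsLinearTopology.hasBasis_open_submodule k).mem_iff.1 hN
    exact ⟨⟨H, hH⟩, hHN⟩
  · have hmap : (G ⊓ H.1).map C.mkQ = G.map C.mkQ :=
      Submodule.eq_of_le_of_finrank_le (Submodule.map_mono inf_le_left)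
        (hmin _ ⟨hG.inter H.2, inf_le_left.trans hGD⟩)
    obtain ⟨x, hx, hxv⟩ : C.mkQ v ∈ (G ⊓ H.1).map C.mkQ := hmap ▸ ⟨v, hv, rfl⟩
    refine ⟨v - x, (Submodule.Quotient.eq C).1 hxv.symm, ?_⟩
    rw [sub_sub_cancel_left]
    exact neg_mem hx.2

namespace IsLatticeFiltration

variable {k : Type u} [Field k] {V W : Type*} [AddCommGroup V] [Module k V] [TopologicalSpace V]
  [IsTopologicalAddGroup V] [AddCommGroup W] [Module k W] [TopologicalSpace W]
  [IsTopologicalAddGroup W] {F : ℤ → Submodule k V}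

theorem baireSpace (hF : IsLatticeFiltration F) : BaireSpace V := by
  let := IsTopologicalAddGroup.rightUniformSpace V
  have := isUniformAddGroup_of_addCommGroup (G := V)
  have := hF.countable_nhds
  have := IsUniformAddGroup.uniformity_countably_generated (α := V)
  have : CompleteSpace V := UniformSpace.complete_of_cauchySeq_tendsto fun x hx => by
    have hcauchy (i : ℤ) : ∃ b, ∀ m ≥ b, ∀ n ≥ b, x n - x m ∈ F i :=
      cauchySeq_iff.1 hx _ <| by
        rw [uniformity_eq_comap_nhds_zero]
        exact Filter.preimage_mem_comap ((hF.isOpen i).mem_nhds (F i).zero_mem)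
    choose b hb using hcauchy
    obtain ⟨v, hv⟩ := hF.complete (fun i => x (b i)) fun i j h => by
      let c := max (b i) (b j)
      have hi := hF.mono h (hb i c (le_max_left _ _) (b i) le_rfl)
      have hj := hb j (b j) le_rfl c (le_max_right _ _)
      simpa only [sub_add_sub_cancel] using (F j).add_mem hi hj
    refine ⟨v, tendsto_sub_nhds_zero_iff.1 (Filter.tendsto_def.2 fun N hN => ?_)⟩
    obtain ⟨i, hi⟩ := hF.basis N hN
    filter_upwards [Filter.eventually_ge_atTop (b i)] with n hn
    have h := (F i).sub_mem (hb i (b i) le_rfl n hn) (hv i)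
    rw [sub_sub_sub_cancel_right] at h
    exact hi h
  infer_instance

variable [IsLinearTopology k W] [T2Space W]

theorem isClosed_map (hF : IsLatticeFiltration F) (f : V →ₗ[k] W) (hf : Continuous f) (j : ℤ) :
    IsClosed ((F j).map f : Set W) := by
  have h := (hF.isLinearlyCompact j).isClosed_range (f ∘ₗ (F j).subtype)
    (hf.comp continuous_subtype_val)
  rwa [← LinearMap.coe_range, LinearMap.range_comp, Submodule.range_subtype] at h

variable [BaireSpace W]

theorem exists_isOpen_map (hF : IsLatticeFiltration F) (f : V →ₗ[k] W) (hf : Continuous f)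
    (hs : Function.Surjective f) : ∃ j, IsOpen ((F j).map f : Set W) := by
  obtain ⟨j, w, hw⟩ := nonempty_interior_of_iUnion_of_closed (hF.isClosed_map f hf) <| by
    refine Set.eq_univ_of_forall fun w => ?_
    obtain ⟨v, rfl⟩ := hs w
    obtain ⟨j, hj⟩ := hF.exhaust v
    exact Set.mem_iUnion.2 ⟨j, v, hj, rfl⟩
  exact ⟨j, ((F j).map f).toAddSubgroup.isOpen_of_mem_nhds (mem_interior_iff_mem_nhds.1 hw)⟩

theorem isOpenMap (hF : IsLatticeFiltration F) (f : V →ₗ[k] W) (hf : Continuous f)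
    (hs : Function.Surjective f) : IsOpenMap f := by
  obtain ⟨j, hj⟩ := hF.exists_isOpen_map f hf hs
  refine (IsTopologicalAddGroup.isOpenMap_iff_nhds_zero (f := f.toAddMonoidHom)).2 fun N hN => ?_
  obtain ⟨i, hi⟩ := hF.basis _ hN
  have hopen := isOpen_of_isClosed_of_fg (hF.isClosed_map f hf i) hj
    (fg_map_map_mkQ (hF.finite i j) f)
  refine Filter.mem_of_superset (hopen.mem_nhds ((F i).map f).zero_mem) ?_
  rintro _ ⟨v, hv, rfl⟩
  exact hi hv

end IsLatticeFiltration

end OpenMapping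

/-! ### Models of admissible diagrams -/

section Models

variable {k : Type u} [Field k]

namespace AdmDiagram

/-- The transition map `X_{i,j} → X_{i',j'}`. -/
def tr (X : AdmDiagram k) {i j i' j' : ℤ} (h : i ≤ j) (h' : i' ≤ j') (a : i ≤ i') (b : j ≤ j') :
    X.obj.obj (pair i j h) →ₗ[k] X.obj.obj (pair i' j' h') :=
  (X.obj.map (homOfLE ⟨a, b⟩)).hom.hom

theorem tr_tr (X : AdmDiagram k) {i j i' j' i'' j'' : ℤ} (h : i ≤ j) (h' : i' ≤ j')
    (h'' : i'' ≤ j'') (a : i ≤ i') (b : j ≤ j') (a' : i' ≤ i'') (b' : j' ≤ j'')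
    (x : X.obj.obj (pair i j h)) :
    X.tr h' h'' a' b' (X.tr h h' a b x) = X.tr h h'' (a.trans a') (b.trans b') x := by
  have : X.obj.map (homOfLE (⟨a, b⟩ : pair i j h ≤ pair i' j' h')) ≫
      X.obj.map (homOfLE (⟨a', b'⟩ : pair i' j' h' ≤ pair i'' j'' h'')) =
      X.obj.map (homOfLE (⟨a.trans a', b.trans b'⟩ : pair i j h ≤ pair i'' j'' h'')) := by
    rw [← Functor.map_comp]; rfl
  exact congrArg (fun f : X.obj.obj (pair i j h) ⟶ X.obj.obj (pair i'' j'' h'') => f.hom.hom x) this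

theorem tr_self (X : AdmDiagram k) {i j : ℤ} (h : i ≤ j) (x : X.obj.obj (pair i j h)) :
    X.tr h h le_rfl le_rfl x = x := by
  have : X.obj.map (homOfLE (le_refl (pair i j h))) = 𝟙 _ := X.obj.map_id _
  exact congrArg (fun f : X.obj.obj (pair i j h) ⟶ X.obj.obj (pair i j h) => f.hom.hom x) this

theorem tr_injective (X : AdmDiagram k) {i j l : ℤ} (h : i ≤ j) (h' : j ≤ l) :
    Function.Injective (X.tr h (h.trans h') le_rfl h') :=
  (X.property i j l h h').1

theorem tr_surjective (X : AdmDiagram k) {i j l : ℤ} (h : i ≤ j) (h' : j ≤ l) :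
    Function.Surjective (X.tr (h.trans h') h' h le_rfl) :=
  (X.property i j l h h').2.2

theorem tr_exact (X : AdmDiagram k) {i j l : ℤ} (h : i ≤ j) (h' : j ≤ l) :
    Function.Exact (X.tr h (h.trans h') le_rfl h') (X.tr (h.trans h') h' h le_rfl) :=
  (X.property i j l h h').2.1

/-- A component of a morphism of diagrams. -/
def app {X Y : AdmDiagram k} (g : X ⟶ Y) {i j : ℤ} (h : i ≤ j) :
    X.obj.obj (pair i j h) →ₗ[k] Y.obj.obj (pair i j h) :=
  (g.hom.app (pair i j h)).hom.hom

theorem app_tr {X Y : AdmDiagram k} (g : X ⟶ Y) {i j i' j' : ℤ} (h : i ≤ j) (h' : i' ≤ j')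
    (a : i ≤ i') (b : j ≤ j') (x : X.obj.obj (pair i j h)) :
    app g h' (X.tr h h' a b x) = Y.tr h h' a b (app g h x) := by
  have := g.hom.naturality (homOfLE (⟨a, b⟩ : pair i j h ≤ pair i' j' h'))
  exact congrArg (fun f : X.obj.obj (pair i j h) ⟶ Y.obj.obj (pair i' j' h') => f.hom.hom x) this

theorem hom_ext {X Y : AdmDiagram k} {g g' : X ⟶ Y}
    (H : ∀ (i j : ℤ) (h : i ≤ j) x, app g h x = app g' h x) : g = g' := by
  apply ObjectProperty.hom_ext
  ext p x
  exact H p.1.1 p.1.2 p.2 x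

/-- Constructor for morphisms of diagrams. -/
def homMk {X Y : AdmDiagram k}
    (f : ∀ (i j : ℤ) (h : i ≤ j), X.obj.obj (pair i j h) →ₗ[k] Y.obj.obj (pair i j h))
    (hf : ∀ (i j i' j' : ℤ) (h : i ≤ j) (h' : i' ≤ j') (a : i ≤ i') (b : j ≤ j')
      (x : X.obj.obj (pair i j h)), f i' j' h' (X.tr h h' a b x) = Y.tr h h' a b (f i j h x)) :
    X ⟶ Y :=
  ObjectProperty.homMk
    { app := fun p => FGModuleCat.ofHom (f p.1.1 p.1.2 p.2)
      naturality := fun p p' r => by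
        apply FGModuleCat.hom_ext
        ext x
        exact hf p.1.1 p.1.2 p'.1.1 p'.1.2 p.2 p'.2 (leOfHom r).1 (leOfHom r).2 x }

@[simp]
theorem app_comp {X Y Z : AdmDiagram k} (f : X ⟶ Y) (g : Y ⟶ Z) {i j : ℤ} (h : i ≤ j)
    (x : X.obj.obj (pair i j h)) : app (f ≫ g) h x = app g h (app f h x) := rfl

end AdmDiagram

variable [TopologicalSpace k]

/-- A model of the diagram `X` on the topological vector space `V`: a lattice filtration `F` of `V`
with identifications `F j / F i ≅ X_{i,j}`, given by surjections `q : F j → X_{i,j}` with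
kernel `F i`. -/
structure Model (X : AdmDiagram k) (V : TopModuleCat.{u} k) where
  F : ℤ → Submodule k V
  isLatticeFiltration : IsLatticeFiltration F
  q : ∀ {i j : ℤ} (h : i ≤ j), F j →ₗ[k] X.obj.obj (pair i j h)
  q_surjective : ∀ {i j : ℤ} (h : i ≤ j), Function.Surjective (q h)
  q_eq_zero : ∀ {i j : ℤ} (h : i ≤ j) (v : F j), q h v = 0 ↔ (v : V) ∈ F i
  q_tr : ∀ {i j i' j' : ℤ} (h : i ≤ j) (h' : i' ≤ j') (a : i ≤ i') (b : j ≤ j') (v : V)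
    (hv : v ∈ F j), q h' ⟨v, isLatticeFiltration.mono b hv⟩ = X.tr h h' a b (q h ⟨v, hv⟩)

/-- The continuous linear map `f` between models of `X` and `Y` induces the morphism `g : X ⟶ Y`
on the subquotients of the filtrations. -/
structure Compat {X Y : AdmDiagram k} {V W : TopModuleCat.{u} k} (M : Model X V) (N : Model Y W)
    (g : X ⟶ Y) (f : V ⟶ W) : Prop where
  map : ∀ j v, v ∈ M.F j → f.hom v ∈ N.F j
  q : ∀ {i j : ℤ} (h : i ≤ j) (v : V) (hv : v ∈ M.F j),
    N.q h ⟨f.hom v, map j v hv⟩ = AdmDiagram.app g h (M.q h ⟨v, hv⟩)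

namespace Model

variable {X : AdmDiagram k} {V : TopModuleCat.{u} k}

theorem mono (M : Model X V) : Monotone M.F := M.isLatticeFiltration.mono

theorem q_eq_q_iff (M : Model X V) {i j : ℤ} (h : i ≤ j) (v w : M.F j) :
    M.q h v = M.q h w ↔ (v - w : V) ∈ M.F i := by
  rw [← sub_eq_zero, ← map_sub, M.q_eq_zero, Submodule.coe_sub]

theorem exists_q_eq (M : Model X V) (j : ℤ) (x : ∀ i (h : i ≤ j), X.obj.obj (pair i j h))
    (hx : ∀ i i' (a : i ≤ i') (h : i' ≤ j),
      X.tr (a.trans h) h a le_rfl (x i (a.trans h)) = x i' h) :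
    ∃ v : M.F j, ∀ i (h : i ≤ j), M.q h v = x i h := by
  choose s hs using fun i (h : i ≤ j) => M.q_surjective h (x i h)
  have s_sub : ∀ i i' (a : i ≤ i') (h : i' ≤ j), (s i (a.trans h) - s i' h : V) ∈ M.F i' :=
    fun i i' a h => by
      rw [← M.q_eq_q_iff h, hs i' h, ← hx i i' a h, ← hs i (a.trans h)]
      exact M.q_tr (a.trans h) h a le_rfl _ (s i (a.trans h)).2
  obtain ⟨v, hv⟩ := M.isLatticeFiltration.complete (fun i => s (min i j) (min_le_right i j))
    fun i i' a => M.mono (min_le_left i' j)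
      (s_sub (min i j) (min i' j) (min_le_min_right j a) (min_le_right i' j))
  have hvj : v ∈ M.F j := (Submodule.sub_mem_iff_left _ (s _ _).2).1 (hv j)
  refine ⟨⟨v, hvj⟩, fun i h => ?_⟩
  rw [← hs i h, q_eq_q_iff]
  simpa only [min_eq_left h] using hv i

theorem exists_compat_diagram {Y : AdmDiagram k} {W : TopModuleCat.{u} k} (M : Model X V)
    (N : Model Y W) (f : V ⟶ W) (hf : ∀ j v, v ∈ M.F j → f.hom v ∈ N.F j) :
    ∃ g : X ⟶ Y, Compat M N g f := by
  have exists_app : ∀ (i j : ℤ) (h : i ≤ j),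
      ∃ g : X.obj.obj (pair i j h) →ₗ[k] Y.obj.obj (pair i j h),
        ∀ v (hv : v ∈ M.F j), g (M.q h ⟨v, hv⟩) = N.q h ⟨f.hom v, hf j v hv⟩ := by
    intro i j h
    obtain ⟨s, hs⟩ := (M.q h).exists_rightInverse_of_surjective
      (LinearMap.range_eq_top.2 (M.q_surjective h))
    refine ⟨N.q h ∘ₗ f.hom.toLinearMap.restrict (hf j) ∘ₗ s, fun v hv => ?_⟩
    have hsv : (s (M.q h ⟨v, hv⟩) - v : V) ∈ M.F i :=
      (M.q_eq_q_iff h _ ⟨v, hv⟩).1 (LinearMap.congr_fun hs _)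
    exact (N.q_eq_q_iff h _ _).2 ((map_sub f.hom _ _) ▸ hf i _ hsv)
  choose g hg using exists_app
  refine ⟨AdmDiagram.homMk g fun i j i' j' h h' a b x => ?_, hf, fun h v hv => (hg _ _ h v hv).symm⟩
  obtain ⟨⟨v, hv⟩, rfl⟩ := M.q_surjective h x
  rw [hg, ← M.q_tr h h' a b v hv, hg, ← N.q_tr h h' a b]

/-- The model of a reindexed diagram obtained by reindexing the filtration. -/
def reindex (M : Model X V) (φ : Bicofinal) : Model (X.reindex φ) V where
  F j := M.F (φ.toFun j)
  isLatticeFiltration := M.isLatticeFiltration.comp_bicofinal φ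
  q h := M.q (φ.mono h)
  q_surjective _ := M.q_surjective _
  q_eq_zero _ := M.q_eq_zero _
  q_tr h h' a b := M.q_tr (φ.mono h) (φ.mono h') (φ.mono a) (φ.mono b)

end Model

section Hom

variable {X Y Z : AdmDiagram k} {V W U : TopModuleCat.{u} k} {M : Model X V} {N : Model Y W}
  {P : Model Z U}

theorem Compat.id (M : Model X V) : Compat M M (𝟙 X) (𝟙 V) where
  map _ _ h := h
  q _ _ _ := rfl

theorem Compat.comp {g : X ⟶ Y} {g' : Y ⟶ Z} {f : V ⟶ W} {f' : W ⟶ U} (c : Compat M N g f)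
    (c' : Compat N P g' f') : Compat M P (g ≫ g') (f ≫ f') where
  map j v h := c'.map j _ (c.map j v h)
  q h v hv := by
    rw [AdmDiagram.app_comp, ← c.q h v hv, ← c'.q h]
    rfl

theorem Compat.hom_unique {g : X ⟶ Y} {f f' : V ⟶ W} (c : Compat M N g f) (c' : Compat M N g f') :
    f = f' := by
  refine ConcreteCategory.hom_ext _ _ fun v => sub_eq_zero.1 ?_
  obtain ⟨j, hv⟩ := M.isLatticeFiltration.exhaust v
  refine N.isLatticeFiltration.separated _ fun i => ?_
  rcases le_total i j with h | h
  · refine (N.q_eq_q_iff h ⟨_, c.map j v hv⟩ ⟨_, c'.map j v hv⟩).1 ?_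
    rw [c.q h v hv, c'.q h v hv]
  · exact N.mono h ((N.F j).sub_mem (c.map j v hv) (c'.map j v hv))

theorem Compat.diagram_hom_unique {g g' : X ⟶ Y} {f : V ⟶ W} (c : Compat M N g f)
    (c' : Compat M N g' f) : g = g' := by
  refine AdmDiagram.hom_ext fun i j h x => ?_
  obtain ⟨⟨v, hv⟩, rfl⟩ := M.q_surjective h x
  rw [← c.q, ← c'.q]

/-- The graph of the linear map `V → W` induced by a morphism `g` of the modelled diagrams: `v` and
`w` lie in a common step of the filtrations, where the class of `w` in each subquotient is the image
under `g` of the class of `v`. -/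
def Corresponds (M : Model X V) (N : Model Y W) (g : X ⟶ Y) (v : V) (w : W) : Prop :=
  ∃ (j : ℤ) (hv : v ∈ M.F j) (hw : w ∈ N.F j), ∀ i (h : i ≤ j),
    N.q h ⟨w, hw⟩ = AdmDiagram.app g h (M.q h ⟨v, hv⟩)

namespace Corresponds

variable {g : X ⟶ Y} {v v' : V} {w w' : W}

theorem exists_q_eq (hvw : Corresponds M N g v w) {j : ℤ} (hv : v ∈ M.F j) :
    ∃ hw : w ∈ N.F j, ∀ i (h : i ≤ j),
      N.q h ⟨w, hw⟩ = AdmDiagram.app g h (M.q h ⟨v, hv⟩) := by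
  obtain ⟨j₀, hv₀, hw₀, hq⟩ := hvw
  rcases le_total j₀ j with hj | hj
  · refine ⟨N.mono hj hw₀, fun i h => ?_⟩
    rcases le_total i j₀ with hi | hi
    · rw [N.q_tr hi h le_rfl hj w hw₀, M.q_tr hi h le_rfl hj v hv₀, AdmDiagram.app_tr, hq]
    · rw [(N.q_eq_zero h _).2 (N.mono hi hw₀), (M.q_eq_zero h _).2 (M.mono hi hv₀), map_zero]
  · have hw : w ∈ N.F j := by
      refine (N.q_eq_zero hj ⟨w, hw₀⟩).1 ?_
      rw [hq, (M.q_eq_zero hj _).2 hv, map_zero]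
    refine ⟨hw, fun i h => Y.tr_injective h hj ?_⟩
    rw [← N.q_tr h (h.trans hj) le_rfl hj w hw, ← AdmDiagram.app_tr,
      ← M.q_tr h (h.trans hj) le_rfl hj v hv, hq]

theorem mem (hvw : Corresponds M N g v w) {j : ℤ} (hv : v ∈ M.F j) : w ∈ N.F j :=
  (hvw.exists_q_eq hv).1

theorem eq_zero (h : Corresponds M N g 0 w) : w = 0 :=
  N.isLatticeFiltration.separated w fun i => h.mem (M.F i).zero_mem

theorem add (h : Corresponds M N g v w) (h' : Corresponds M N g v' w') :
    Corresponds M N g (v + v') (w + w') := by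
  obtain ⟨j₁, hv, -⟩ := id h
  obtain ⟨j₂, hv', -⟩ := id h'
  have hv := M.mono (le_max_left j₁ j₂) hv
  have hv' := M.mono (le_max_right j₁ j₂) hv'
  obtain ⟨hw, hq⟩ := h.exists_q_eq hv
  obtain ⟨hw', hq'⟩ := h'.exists_q_eq hv'
  refine ⟨max j₁ j₂, add_mem hv hv', add_mem hw hw', fun i hi => ?_⟩
  simpa only [← map_add, AddMemClass.mk_add_mk] using congrArg₂ (· + ·) (hq i hi) (hq' i hi)

theorem smul (c : k) (h : Corresponds M N g v w) : Corresponds M N g (c • v) (c • w) := by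
  obtain ⟨j, hv, hw, hq⟩ := h
  refine ⟨j, (M.F j).smul_mem c hv, (N.F j).smul_mem c hw, fun i hi => ?_⟩
  simpa only [← map_smul, SetLike.mk_smul_mk] using congrArg (c • ·) (hq i hi)

theorem exists_right (M : Model X V) (N : Model Y W) (g : X ⟶ Y) (v : V) :
    ∃ w, Corresponds M N g v w := by
  obtain ⟨j, hv⟩ := M.isLatticeFiltration.exhaust v
  obtain ⟨w, hw⟩ := N.exists_q_eq j (fun i h => AdmDiagram.app g h (M.q h ⟨v, hv⟩))
    fun i i' a h => by rw [← AdmDiagram.app_tr, ← M.q_tr (a.trans h) h a le_rfl v hv]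
  exact ⟨w, j, hv, w.2, hw⟩

theorem exists_linearMap (M : Model X V) (N : Model Y W) (g : X ⟶ Y) :
    ∃ f : V →ₗ[k] W, ∀ v, Corresponds M N g v (f v) := by
  choose f hf using exists_right M N g
  have eq_of_corresponds : ∀ {v w}, Corresponds M N g v w → f v = w := fun {v w} h => by
    refine sub_eq_zero.1 (Corresponds.eq_zero (M := M) (N := N) (g := g) ?_)
    simpa [sub_eq_add_neg] using (hf v).add (h.smul (-1))
  exact ⟨⟨⟨f, fun v v' => eq_of_corresponds ((hf v).add (hf v'))⟩,
    fun c v => eq_of_corresponds ((hf v).smul c)⟩, hf⟩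

end Corresponds

theorem exists_compat_hom (M : Model X V) (N : Model Y W) (g : X ⟶ Y) :
    ∃ f : V ⟶ W, Compat M N g f := by
  obtain ⟨f, hf⟩ := Corresponds.exists_linearMap M N g
  have hf_cont : Continuous f := by
    refine continuous_of_continuousAt_zero f.toAddMonoidHom fun S hS => ?_
    rw [LinearMap.toAddMonoidHom_coe, map_zero] at hS
    obtain ⟨i, hi⟩ := N.isLatticeFiltration.basis S hS
    exact Filter.mem_map.2 <| Filter.mem_of_superset
      ((M.isLatticeFiltration.isOpen i).mem_nhds (M.F i).zero_mem) fun v hv => hi ((hf v).mem hv)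
  exact ⟨ConcreteCategory.ofHom ⟨f, hf_cont⟩, fun j v hv => (hf v).mem hv,
    fun h v hv => ((hf v).exists_q_eq hv).2 _ h⟩

theorem exists_compat_iso (M : Model X V) (N : Model X W) :
    ∃ e : V ≅ W, Compat M N (𝟙 X) e.hom := by
  obtain ⟨f, hf⟩ := exists_compat_hom M N (𝟙 X)
  obtain ⟨f', hf'⟩ := exists_compat_hom N M (𝟙 X)
  exact ⟨⟨f, f', (hf.comp hf').hom_unique (Compat.id M),
    (hf'.comp hf).hom_unique (Compat.id N)⟩, hf⟩

end Hom

end Models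

/-! ### The graded diagram of a lattice filtration -/

namespace IsLatticeFiltration

section Graded

variable {k : Type u} [Field k] {V : Type u} [AddCommGroup V] [Module k V] [TopologicalSpace V]
  {F : ℤ → Submodule k V}

/-- The subquotient `F j / F i`, as an object of the category of finite-dimensional spaces; if
`i > j` it is zero. -/
def gr (hF : IsLatticeFiltration F) (i j : ℤ) : FGModuleCat.{u} k :=
  haveI : Module.Finite k (F j ⧸ (F i).submoduleOf (F j)) := (fg_map_mkQ_iff _ _).1 (hF.finite i j)
  FGModuleCat.of k (F j ⧸ (F i).submoduleOf (F j))

/-- The projection `F j → F j / F i`. -/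
def grMk (hF : IsLatticeFiltration F) (i j : ℤ) : F j →ₗ[k] hF.gr i j :=
  ((F i).submoduleOf (F j)).mkQ

theorem grMk_surjective (hF : IsLatticeFiltration F) (i j : ℤ) :
    Function.Surjective (hF.grMk i j) :=
  Submodule.mkQ_surjective _

theorem grMk_eq_zero (hF : IsLatticeFiltration F) {i j : ℤ} (v : F j) :
    hF.grMk i j v = 0 ↔ (v : V) ∈ F i :=
  Submodule.Quotient.mk_eq_zero _

/-- The transition map `F j / F i → F j' / F i'`. -/
def grMap (hF : IsLatticeFiltration F) {i j i' j' : ℤ} (a : i ≤ i') (b : j ≤ j') :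
    hF.gr i j →ₗ[k] hF.gr i' j' :=
  Submodule.mapQ _ _ (Submodule.inclusion (hF.mono b)) fun _ hv => hF.mono a hv

theorem grMap_injective (hF : IsLatticeFiltration F) (i : ℤ) {j l : ℤ} (h : j ≤ l) :
    Function.Injective (hF.grMap (le_refl i) h) := by
  refine (injective_iff_map_eq_zero _).2 fun x hx => ?_
  obtain ⟨x, rfl⟩ := hF.grMk_surjective i j x
  exact (hF.grMk_eq_zero x).2 ((hF.grMk_eq_zero (Submodule.inclusion (hF.mono h) x)).1 hx)

theorem grMap_surjective (hF : IsLatticeFiltration F) {i j : ℤ} (h : i ≤ j) (l : ℤ) :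
    Function.Surjective (hF.grMap h (le_refl l)) := by
  intro y
  obtain ⟨y, rfl⟩ := hF.grMk_surjective j l y
  exact ⟨hF.grMk i l y, rfl⟩

theorem grMap_exact (hF : IsLatticeFiltration F) {i j l : ℤ} (hij : i ≤ j) (hjl : j ≤ l) :
    Function.Exact (hF.grMap (le_refl i) hjl) (hF.grMap hij (le_refl l)) := by
  intro y
  obtain ⟨y, rfl⟩ := hF.grMk_surjective i l y
  constructor
  · exact fun hy => ⟨hF.grMk i j ⟨y, (hF.grMk_eq_zero y).1 hy⟩, rfl⟩
  · rintro ⟨x, hx⟩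
    obtain ⟨x, rfl⟩ := hF.grMk_surjective i j x
    have hxy : (x - y : V) ∈ F i :=
      (hF.grMk_eq_zero (Submodule.inclusion (hF.mono hjl) x - y)).1
        ((map_sub _ _ _).trans (sub_eq_zero.2 hx))
    refine (hF.grMk_eq_zero y).2 ?_
    simpa using (F j).sub_mem x.2 (hF.mono hij hxy)

/-- The admissible diagram `(i, j) ↦ F j / F i`. -/
def diagram (hF : IsLatticeFiltration F) : AdmDiagram k :=
  ⟨{ obj := fun p => hF.gr p.1.1 p.1.2
     map := fun {p q} f => ConcreteCategory.ofHom (C := FGModuleCat.{u} k)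
      (X := hF.gr p.1.1 p.1.2) (Y := hF.gr q.1.1 q.1.2) (hF.grMap (leOfHom f).1 (leOfHom f).2)
     map_id := fun _ => FGModuleCat.hom_ext (Submodule.linearMap_qext _ rfl)
     map_comp := fun _ _ => FGModuleCat.hom_ext (Submodule.linearMap_qext _ rfl) },
    fun i _ l hij hjl =>
      ⟨hF.grMap_injective i hjl, hF.grMap_exact hij hjl, hF.grMap_surjective hij l⟩⟩

end Graded

/-- The tautological model of the graded diagram of a lattice filtration. -/
def model {k : Type u} [Field k] [TopologicalSpace k] {V : TopModuleCat.{u} k}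
    {F : ℤ → Submodule k V} (hF : IsLatticeFiltration F) : Model hF.diagram V where
  F := F
  isLatticeFiltration := hF
  q _ := hF.grMk _ _
  q_surjective _ := hF.grMk_surjective _ _
  q_eq_zero _ := hF.grMk_eq_zero
  q_tr _ _ _ _ _ _ := rfl

end IsLatticeFiltration

/-! ### The canonical model of the realization -/

theorem surjective_π_app_of_surjective_map {G : ℤ ⥤ Type u} {c : Cone G} (hc : IsLimit c)
    (hG : ∀ {i j : ℤ} (a : i ⟶ j), Function.Surjective (G.map a)) (i : ℤ) :
    Function.Surjective (c.π.app i) := by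
  let K : ℕᵒᵖ ⥤ ℤ :=
    { obj n := i - (n.unop : ℤ)
      map a := homOfLE (sub_le_sub_left (Int.ofNat_le.2 (leOfHom a.unop)) i) }
  have : K.Initial := K.initial_of_exists_of_isCofiltered
    (fun j => ⟨.op (i - j).toNat, ⟨homOfLE (by simp only [K]; omega)⟩⟩)
    fun {j n} _ _ => ⟨n, 𝟙 n, Subsingleton.elim _ _⟩
  have h := Types.surjective_π_app_zero_of_surjective_map
    ((Functor.Initial.isLimitWhiskerEquiv K c).symm hc) fun n => hG _
  have e : K.obj (.op 0) = i := by simp [K]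
  rw [← e]
  exact h

theorem AdmDiagram.eq_zero_of_diag {k : Type u} [Field k] (X : AdmDiagram k) {j : ℤ}
    (x : X.obj.obj (pair j j le_rfl)) : x = 0 := by
  have h := (X.tr_exact (le_refl j) (le_refl j) x).2 ⟨x, X.tr_self _ _⟩
  rwa [X.tr_self] at h

section TopModules

variable (k : Type u) [Field k] [TopologicalSpace k]

/-- The functor taking a topological vector space to its underlying set. -/
abbrev forgetTop : TopModuleCat.{u} k ⥤ Type u :=
  forget₂ (TopModuleCat.{u} k) (ModuleCat.{u} k) ⋙ forget (ModuleCat.{u} k)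

instance : PreservesLimitsOfShape ℤ (forgetTop k) := inferInstance

instance : PreservesColimitsOfShape ℤ (forgetTop k) := by
  have := preservesSmallestFilteredColimits_of_preservesFilteredColimits.{u, u}
    (forget (ModuleCat.{u} k))
  exact comp_preservesColimitsOfShape _ _

variable {k} (F : ℤ ⥤ TopModuleCat.{u} k)

theorem limit_ext {x y : (limit F : TopModuleCat.{u} k)}
    (h : ∀ i, (limit.π F i).hom x = (limit.π F i).hom y) : x = y :=
  (Types.isLimitEquivSections (isLimitOfPreserves (forgetTop k) (limit.isLimit F))).injective
    (Subtype.ext (funext h))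

theorem exists_limit_π_eq (x : ∀ i, F.obj i) (hx : ∀ i j (a : i ⟶ j), (F.map a).hom (x i) = x j) :
    ∃ l : (limit F : TopModuleCat.{u} k), ∀ i, (limit.π F i).hom l = x i :=
  let e := Types.isLimitEquivSections (isLimitOfPreserves (forgetTop k) (limit.isLimit F))
  ⟨e.symm ⟨x, fun a => hx _ _ a⟩, fun i =>
    congrFun (congrArg Subtype.val (e.apply_symm_apply ⟨x, fun a => hx _ _ a⟩)) i⟩

theorem limit_π_surjective (hF : ∀ {i j : ℤ} (a : i ⟶ j), Function.Surjective (F.map a).hom)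
    (i : ℤ) : Function.Surjective (limit.π F i).hom :=
  surjective_π_app_of_surjective_map (isLimitOfPreserves (forgetTop k) (limit.isLimit F)) hF i

theorem nhds_zero_limit : nhds (0 : (limit F : TopModuleCat.{u} k)) =
    ⨅ i, Filter.comap (limit.π F i).hom (nhds (0 : F.obj i)) := by
  have htop : (limit F : TopModuleCat.{u} k).topologicalSpace =
      ⨅ i, (F.obj i).topologicalSpace.induced (limit.π F i).hom :=
    TopCat.induced_of_isLimit _
      (isLimitOfPreserves (forget₂ (TopModuleCat.{u} k) TopCat) (limit.isLimit F))
  have hnhds : nhds (0 : (limit F : TopModuleCat.{u} k)) =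
      @nhds _ (⨅ i, (F.obj i).topologicalSpace.induced (limit.π F i).hom) 0 := by rw [← htop]
  rw [hnhds, nhds_iInf]
  exact iInf_congr fun i => by rw [nhds_induced, map_zero]

theorem exists_colimit_ι_eq (x : (colimit F : TopModuleCat.{u} k)) :
    ∃ (j : ℤ) (y : F.obj j), (colimit.ι F j).hom y = x :=
  Types.jointly_surjective_of_isColimit
    (isColimitOfPreserves (forgetTop k) (colimit.isColimit F)) x

theorem colimit_ι_injective (hF : ∀ {i j : ℤ} (a : i ⟶ j), Function.Injective (F.map a).hom)
    (j : ℤ) : Function.Injective (colimit.ι F j).hom := by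
  intro x y hxy
  obtain ⟨l, f, e⟩ := (Types.FilteredColimit.isColimit_eq_iff'
    (isColimitOfPreserves (forgetTop k) (colimit.isColimit F)) x y).1 hxy
  exact hF f e

variable [DiscreteTopology k]

theorem isOpen_of_isOpen_comap_colimit_ι (U : Submodule k (colimit F : TopModuleCat.{u} k))
    (hU : ∀ j, IsOpen (U.comap (colimit.ι F j).hom.toLinearMap : Set (F.obj j))) :
    IsOpen (U : Set (colimit F : TopModuleCat.{u} k)) := by
  let _ : TopologicalSpace ((colimit F : TopModuleCat.{u} k) ⧸ U) := ⊥
  have : DiscreteTopology ((colimit F : TopModuleCat.{u} k) ⧸ U) := ⟨rfl⟩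
  have : ContinuousSMul k ((colimit F : TopModuleCat.{u} k) ⧸ U) :=
    ⟨continuous_of_discreteTopology⟩
  let Q : TopModuleCat.{u} k := TopModuleCat.of k ((colimit F : TopModuleCat.{u} k) ⧸ U)
  have hq (j : ℤ) : Continuous (U.mkQ ∘ₗ (colimit.ι F j).hom.toLinearMap) :=
    continuous_of_isOpen_le_ker _ (hU j) fun _ hx => (Submodule.Quotient.mk_eq_zero U).2 hx
  let c : Cocone F :=
    { pt := Q
      ι :=
        { app := fun j => TopModuleCat.ofHom ⟨U.mkQ ∘ₗ (colimit.ι F j).hom.toLinearMap, hq j⟩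
          naturality := fun i j a => by
            refine ConcreteCategory.hom_ext _ _ fun x => congrArg U.mkQ ?_
            exact congrArg (fun f : F.obj i ⟶ colimit F => f.hom x) (colimit.w F a) } }
  have hdesc (v : (colimit F : TopModuleCat.{u} k)) : (colimit.desc F c).hom v = U.mkQ v := by
    obtain ⟨j, x, rfl⟩ := exists_colimit_ι_eq F v
    exact congrArg (fun f : F.obj j ⟶ Q => f.hom x) (colimit.ι_desc c j)
  have hpreimage : (U : Set (colimit F : TopModuleCat.{u} k)) =
      (colimit.desc F c).hom ⁻¹' {(0 : Q)} := by
    ext v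
    exact (Submodule.Quotient.mk_eq_zero U).symm.trans (Eq.congr_left (hdesc v).symm)
  rw [hpreimage]
  exact (isOpen_discrete (α := (colimit F : TopModuleCat.{u} k) ⧸ U) {0}).preimage
    (colimit.desc F c).hom.continuous

instance (V : FGModuleCat.{u} k) : DiscreteTopology ((discrete k).obj V) := ⟨rfl⟩

end TopModules

section Realization

variable {k : Type u} [Field k] [TopologicalSpace k] [DiscreteTopology k]

namespace AdmDiagram

/-- The linearly compact space `lim_i X_{i,j}`. -/
abbrev level (X : AdmDiagram k) (j : ℤ) : TopModuleCat.{u} k :=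
  ((innerLim (discrete k)).obj X.obj).obj j

/-- The space `Φ(X) = colim_j lim_i X_{i,j}` realizing the diagram `X`. -/
abbrev real (X : AdmDiagram k) : TopModuleCat.{u} k :=
  (colimLim (discrete k) (𝟭 _)).obj X.obj

/-- The projection from `lim_i X_{i,j}` to the value of the clamped diagram at `i`, which is
`X_{j,j} = 0` for `i > j`. -/
def clampProj (X : AdmDiagram k) (j i : ℤ) :
    X.level j →ₗ[k] X.obj.obj (pair (min i j) j (min_le_right i j)) :=
  (limit.π (clamp.obj j ⋙ X.obj ⋙ discrete k) i).hom.toLinearMap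

/-- The projection from `lim_i X_{i,j}` to `X_{i,j}`. -/
def proj (X : AdmDiagram k) {i j : ℤ} (h : i ≤ j) : X.level j →ₗ[k] X.obj.obj (pair i j h) :=
  X.tr (min_le_right i j) h (min_le_left i j) le_rfl ∘ₗ X.clampProj j i

/-- The inclusion of `lim_i X_{i,j}` in `lim_i X_{i,j'}` for `j ≤ j'`. -/
def levelMap (X : AdmDiagram k) {j j' : ℤ} (h : j ≤ j') : X.level j ⟶ X.level j' :=
  ((innerLim (discrete k)).obj X.obj).map (homOfLE h)

theorem tr_clampProj (X : AdmDiagram k) {j i i' : ℤ} (a : i ≤ i') (l : X.level j) :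
    X.tr (min_le_right i j) (min_le_right i' j) (min_le_min_right j a) le_rfl (X.clampProj j i l) =
      X.clampProj j i' l :=
  congrArg (fun f : X.level j ⟶ _ => f.hom l)
    (limit.w (clamp.obj j ⋙ X.obj ⋙ discrete k) (homOfLE a))

theorem clampProj_eq_proj (X : AdmDiagram k) (j i : ℤ) (l : X.level j) :
    X.clampProj j i l = X.proj (min_le_right i j) l :=
  (X.tr_clampProj (min_le_left i j) l).symm

theorem proj_apply (X : AdmDiagram k) {i j : ℤ} (h : i ≤ j) (l : X.level j) :
    X.proj h l = X.tr (min_le_right i j) h (min_le_left i j) le_rfl (X.clampProj j i l) := rfl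

theorem tr_proj (X : AdmDiagram k) {i i' j : ℤ} (a : i ≤ i') (h : i' ≤ j) (l : X.level j) :
    X.tr (a.trans h) h a le_rfl (X.proj (a.trans h) l) = X.proj h l := by
  rw [proj_apply, proj_apply, ← X.tr_clampProj a, tr_tr, tr_tr]

theorem clampProj_levelMap (X : AdmDiagram k) {i j j' : ℤ} (h' : j ≤ j') (l : X.level j) :
    X.clampProj j' i ((X.levelMap h').hom l) =
      X.tr (min_le_right i j) (min_le_right i j') (min_le_min_left i h') h' (X.clampProj j i l) :=
  congrArg (fun f : X.level j ⟶ _ => f.hom l)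
    (limMap_π (Functor.whiskerRight (clamp.map (homOfLE h')) (X.obj ⋙ discrete k)) i)

theorem proj_levelMap (X : AdmDiagram k) {i j j' : ℤ} (h : i ≤ j) (h' : j ≤ j') (l : X.level j) :
    X.proj (h.trans h') ((X.levelMap h').hom l) = X.tr h (h.trans h') le_rfl h' (X.proj h l) := by
  rw [proj_apply, proj_apply, clampProj_levelMap, tr_tr, tr_tr]

theorem proj_self_levelMap (X : AdmDiagram k) {i j : ℤ} (h : i ≤ j) (l : X.level i) :
    X.proj h ((X.levelMap h).hom l) = 0 := by
  rw [X.proj_levelMap le_rfl h, X.eq_zero_of_diag (X.proj le_rfl l), map_zero]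

theorem level_ext (X : AdmDiagram k) {j : ℤ} {l l' : X.level j}
    (hl : ∀ i (h : i ≤ j), X.proj h l = X.proj h l') : l = l' := by
  refine limit_ext (clamp.obj j ⋙ X.obj ⋙ discrete k) fun i => ?_
  change X.clampProj j i l = X.clampProj j i l'
  rw [clampProj_eq_proj, clampProj_eq_proj, hl]

theorem exists_proj_eq (X : AdmDiagram k) {j : ℤ} (x : ∀ i (h : i ≤ j), X.obj.obj (pair i j h))
    (hx : ∀ i i' (a : i ≤ i') (h : i' ≤ j),
      X.tr (a.trans h) h a le_rfl (x i (a.trans h)) = x i' h) :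
    ∃ l : X.level j, ∀ i (h : i ≤ j), X.proj h l = x i h := by
  obtain ⟨l, hl⟩ := exists_limit_π_eq (clamp.obj j ⋙ X.obj ⋙ discrete k)
    (fun i => x (min i j) (min_le_right i j))
    fun i i' a => hx _ _ (min_le_min_right j (leOfHom a)) (min_le_right i' j)
  exact ⟨l, fun i h => (congrArg (X.tr _ h (min_le_left i j) le_rfl) (hl i)).trans (hx _ _ _ h)⟩

theorem proj_surjective (X : AdmDiagram k) {i j : ℤ} (h : i ≤ j) :
    Function.Surjective (X.proj h) := by
  refine (X.tr_surjective _ h).comp (limit_π_surjective (clamp.obj j ⋙ X.obj ⋙ discrete k) ?_ i)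
  exact fun a => X.tr_surjective (min_le_min_right j (leOfHom a)) (min_le_right _ j)

theorem exists_forall_proj_eq_zero_mem (X : AdmDiagram k) {j : ℤ} {N : Set (X.level j)}
    (hN : N ∈ nhds 0) : ∃ (i : ℤ) (h : i ≤ j), ∀ l, X.proj h l = 0 → l ∈ N := by
  have hnhds : nhds (0 : X.level j) = ⨅ i, Filter.principal {l | X.clampProj j i l = 0} := by
    refine (nhds_zero_limit (clamp.obj j ⋙ X.obj ⋙ discrete k)).trans (iInf_congr fun i => ?_)
    have : DiscreteTopology ((clamp.obj j ⋙ X.obj ⋙ discrete k).obj i) := ⟨rfl⟩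
    rw [nhds_discrete, ← Filter.principal_singleton, Filter.comap_principal]
    rfl
  have hmono : Monotone fun i => {l : X.level j | X.clampProj j i l = 0} :=
    fun i i' a l (hl : _ = 0) => by
      change X.clampProj j i' l = 0
      rw [← X.tr_clampProj a, hl, map_zero]
  obtain ⟨i, hi⟩ := (Filter.mem_iInf_of_directed
    (Filter.monotone_principal.comp hmono).directed_ge N).1 (hnhds ▸ hN)
  exact ⟨min i j, min_le_right i j, fun l hl => hi ((X.clampProj_eq_proj j i l).trans hl)⟩

theorem isOpen_ker_proj (X : AdmDiagram k) {i j : ℤ} (h : i ≤ j) :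
    IsOpen (LinearMap.ker (X.proj h) : Set (X.level j)) :=
  have hopen : IsOpen (X := (discrete k).obj (X.obj.obj (pair (min i j) j (min_le_right i j))))
      {x | X.tr (min_le_right i j) h (min_le_left i j) le_rfl x = 0} :=
    isOpen_discrete (α := (discrete k).obj (X.obj.obj (pair (min i j) j (min_le_right i j)))) _
  hopen.preimage (limit.π (clamp.obj j ⋙ X.obj ⋙ discrete k) i).hom.continuous

theorem exists_levelMap_eq (X : AdmDiagram k) {j j' : ℤ} (h : j ≤ j') (l' : X.level j')
    (hl' : X.proj h l' = 0) : ∃ l, (X.levelMap h).hom l = l' := by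
  choose x hx using fun i (hi : i ≤ j) =>
    (X.tr_exact hi h (X.proj (hi.trans h) l')).1 (by rw [tr_proj, hl'])
  obtain ⟨l, hl⟩ := X.exists_proj_eq x fun i i' a hi => by
    apply X.tr_injective hi h
    rw [tr_tr, hx, ← X.tr_proj a, ← hx, tr_tr]
  refine ⟨l, X.level_ext fun i hi => ?_⟩
  rcases le_total i j with hij | hij
  · rw [X.proj_levelMap hij, hl, hx]
  · rw [← X.tr_proj hij hi, ← X.tr_proj hij hi, hl', proj_self_levelMap]

theorem levelMap_injective (X : AdmDiagram k) {j j' : ℤ} (h : j ≤ j') :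
    Function.Injective (X.levelMap h).hom := by
  intro l l' e
  refine X.level_ext fun i hi => X.tr_injective hi h ?_
  rw [← X.proj_levelMap hi h, ← X.proj_levelMap hi h, e]

/-- The inclusion of `lim_i X_{i,j}` in the realization of `X`. -/
def ofLevel (X : AdmDiagram k) (j : ℤ) : X.level j ⟶ X.real :=
  colimit.ι ((innerLim (discrete k)).obj X.obj ⋙ 𝟭 _) j

theorem ofLevel_levelMap (X : AdmDiagram k) {j j' : ℤ} (h : j ≤ j') (l : X.level j) :
    (X.ofLevel j').hom ((X.levelMap h).hom l) = (X.ofLevel j).hom l :=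
  congrArg (fun f : X.level j ⟶ X.real => f.hom l)
    (colimit.w ((innerLim (discrete k)).obj X.obj ⋙ 𝟭 _) (homOfLE h))

theorem exists_ofLevel_eq (X : AdmDiagram k) (v : X.real) : ∃ j l, (X.ofLevel j).hom l = v :=
  exists_colimit_ι_eq ((innerLim (discrete k)).obj X.obj ⋙ 𝟭 _) v

theorem ofLevel_injective (X : AdmDiagram k) (j : ℤ) : Function.Injective (X.ofLevel j).hom :=
  colimit_ι_injective ((innerLim (discrete k)).obj X.obj ⋙ 𝟭 _)
    (fun a => X.levelMap_injective (leOfHom a)) j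

/-- The filtration of the realization of `X` by the subspaces `lim_i X_{i,j}`. -/
def filtration (X : AdmDiagram k) (j : ℤ) : Submodule k X.real :=
  LinearMap.range (X.ofLevel j).hom.toLinearMap

theorem filtration_mono (X : AdmDiagram k) : Monotone X.filtration := by
  rintro j j' h _ ⟨l, rfl⟩
  exact ⟨(X.levelMap h).hom l, X.ofLevel_levelMap h l⟩

theorem ofLevel_mem_filtration_iff (X : AdmDiagram k) {i j : ℤ} (h : i ≤ j) (l : X.level j) :
    (X.ofLevel j).hom l ∈ X.filtration i ↔ X.proj h l = 0 := by
  constructor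
  · rintro ⟨l', hl'⟩
    have : (X.levelMap h).hom l' = l :=
      X.ofLevel_injective j ((X.ofLevel_levelMap h l').trans hl')
    rw [← this, proj_self_levelMap]
  · intro hl
    obtain ⟨l', rfl⟩ := X.exists_levelMap_eq h l hl
    exact ⟨l', (X.ofLevel_levelMap h l').symm⟩

theorem isOpen_filtration (X : AdmDiagram k) (j : ℤ) : IsOpen (X.filtration j : Set X.real) := by
  refine isOpen_of_isOpen_comap_colimit_ι ((innerLim (discrete k)).obj X.obj ⋙ 𝟭 _) _ fun j' => ?_
  change IsOpen {l : X.level j' | (X.ofLevel j').hom l ∈ X.filtration j}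
  rcases le_total j j' with h | h
  · have hker : {l : X.level j' | (X.ofLevel j').hom l ∈ X.filtration j} =
        LinearMap.ker (X.proj h) := Set.ext fun l => X.ofLevel_mem_filtration_iff h l
    rw [hker]
    exact X.isOpen_ker_proj h
  · have huniv : {l : X.level j' | (X.ofLevel j').hom l ∈ X.filtration j} = Set.univ :=
      Set.eq_univ_of_forall fun l => X.filtration_mono h ⟨l, rfl⟩
    rw [huniv]
    exact isOpen_univ

/-- The projection from the piece `lim_i X_{i,j}` of the realization to `X_{i,j}`. -/
def filtrationProj (X : AdmDiagram k) {i j : ℤ} (h : i ≤ j) :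
    X.filtration j →ₗ[k] X.obj.obj (pair i j h) :=
  X.proj h ∘ₗ
    (LinearEquiv.ofInjective (X.ofLevel j).hom.toLinearMap (X.ofLevel_injective j)).symm.toLinearMap

theorem filtrationProj_ofLevel (X : AdmDiagram k) {i j : ℤ} (h : i ≤ j) (l : X.level j)
    (hl : (X.ofLevel j).hom l ∈ X.filtration j) :
    X.filtrationProj h ⟨(X.ofLevel j).hom l, hl⟩ = X.proj h l :=
  congrArg (X.proj h) ((LinearEquiv.symm_apply_eq _).2 rfl)

theorem filtrationProj_surjective (X : AdmDiagram k) {i j : ℤ} (h : i ≤ j) :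
    Function.Surjective (X.filtrationProj h) :=
  (X.proj_surjective h).comp (LinearEquiv.surjective _)

theorem filtrationProj_eq_zero (X : AdmDiagram k) {i j : ℤ} (h : i ≤ j) (v : X.filtration j) :
    X.filtrationProj h v = 0 ↔ (v : X.real) ∈ X.filtration i := by
  obtain ⟨_, l, rfl⟩ := v
  exact (Eq.congr_left (X.filtrationProj_ofLevel h l _)).trans
    (X.ofLevel_mem_filtration_iff h l).symm

theorem filtrationProj_tr (X : AdmDiagram k) {i j i' j' : ℤ} (h : i ≤ j) (h' : i' ≤ j')
    (a : i ≤ i') (b : j ≤ j') (v : X.real) (hv : v ∈ X.filtration j) :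
    X.filtrationProj h' ⟨v, X.filtration_mono b hv⟩ =
      X.tr h h' a b (X.filtrationProj h ⟨v, hv⟩) := by
  obtain ⟨l, rfl⟩ := hv
  calc X.filtrationProj h' ⟨(X.ofLevel j).hom l, _⟩
      = X.filtrationProj h' ⟨(X.ofLevel j').hom ((X.levelMap b).hom l), _, rfl⟩ :=
        congrArg (X.filtrationProj h') (Subtype.ext (X.ofLevel_levelMap b l).symm)
    _ = X.proj h' ((X.levelMap b).hom l) := X.filtrationProj_ofLevel h' _ _
    _ = X.tr h h' a b (X.proj h l) := by rw [← X.tr_proj a h', X.proj_levelMap h b, tr_tr]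
    _ = _ := congrArg (X.tr h h' a b) (X.filtrationProj_ofLevel h l ⟨l, rfl⟩).symm

theorem fg_map_mkQ_filtration (X : AdmDiagram k) (i j : ℤ) :
    ((X.filtration j).map (X.filtration i).mkQ).FG := by
  rw [fg_map_mkQ_iff]
  rcases le_total i j with h | h
  · have hker : (X.filtration i).submoduleOf (X.filtration j) =
        LinearMap.ker (X.filtrationProj h) :=
      Submodule.ext fun v => (X.filtrationProj_eq_zero h v).symm
    rw [hker]
    exact Module.Finite.equiv
      ((X.filtrationProj h).quotKerEquivOfSurjective (X.filtrationProj_surjective h)).symm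
  · rw [Submodule.submoduleOf_eq_top.2 (X.filtration_mono h)]
    infer_instance

theorem filtration_complete (X : AdmDiagram k) (x : ℤ → X.real)
    (hx : ∀ i j, i ≤ j → x i - x j ∈ X.filtration j) : ∃ v, ∀ i, v - x i ∈ X.filtration i := by
  refine (complete_iff_nat X.filtration_mono).2 (fun x hx => ?_) x hx
  have x_sub_mem {n m : ℕ} (h : n ≤ m) : x m - x n ∈ X.filtration (-n) :=
    sub_mem_of_succ (G := fun n : ℕ => X.filtration (-n))
      (fun _ _ h => X.filtration_mono (by simpa using h)) hx h
  obtain ⟨j, hj, x_mem⟩ : ∃ j : ℤ, 0 ≤ j ∧ ∀ n, x n ∈ X.filtration j := by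
    obtain ⟨j, l, hl⟩ := X.exists_ofLevel_eq (x 0)
    refine ⟨max j 0, le_max_right j 0, fun n => ?_⟩
    simpa only [sub_add_cancel] using add_mem
      (X.filtration_mono (by simp) (x_sub_mem (Nat.zero_le n)))
      (X.filtration_mono (le_max_left j 0) ⟨l, hl⟩)
  choose l hl using x_mem
  have proj_eq_iff {i : ℤ} (h : i ≤ j) (l l' : X.level j) : X.proj h l = X.proj h l' ↔
      (X.ofLevel j).hom l - (X.ofLevel j).hom l' ∈ X.filtration i := by
    rw [← sub_eq_zero, ← map_sub, ← map_sub, X.ofLevel_mem_filtration_iff]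
  obtain ⟨v, hv⟩ := X.exists_proj_eq (fun i h => X.proj h (l (-i).toNat)) fun i i' a h => by
    rw [tr_proj, proj_eq_iff]
    refine X.filtration_mono (by omega) (?_ : _ ∈ X.filtration (-(-i').toNat))
    simpa only [← hl] using! x_sub_mem (Int.toNat_le_toNat (neg_le_neg a))
  refine ⟨(X.ofLevel j).hom v, fun n => ?_⟩
  have hn := (proj_eq_iff (by omega) _ _).1 (hv (-n) (by omega))
  rw [neg_neg, Int.toNat_natCast] at hn
  simpa only [← hl n] using! hn

theorem isLatticeFiltration (X : AdmDiagram k) : IsLatticeFiltration X.filtration where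
  mono := X.filtration_mono
  isOpen := X.isOpen_filtration
  basis N hN := by
    have hN₀ : (X.ofLevel 0).hom ⁻¹' N ∈ nhds (0 : X.level 0) :=
      (X.ofLevel 0).hom.continuous.continuousAt.preimage_mem_nhds (by rwa [map_zero])
    obtain ⟨i, hi, hiN⟩ := X.exists_forall_proj_eq_zero_mem hN₀
    refine ⟨i, ?_⟩
    rintro _ ⟨l, rfl⟩
    change (X.ofLevel i).hom l ∈ N
    rw [← X.ofLevel_levelMap hi]
    exact hiN _ (X.proj_self_levelMap hi l)
  exhaust v := X.exists_ofLevel_eq v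
  separated v hv := by
    obtain ⟨j, l, rfl⟩ := X.exists_ofLevel_eq v
    have hl : l = 0 := X.level_ext fun i h => by
      rw [(X.ofLevel_mem_filtration_iff h l).1 (hv i), map_zero]
    rw [hl, map_zero]
  finite := X.fg_map_mkQ_filtration
  complete := X.filtration_complete

/-- The canonical model of a diagram, on its realization. -/
def model (X : AdmDiagram k) : Model X X.real where
  F := X.filtration
  isLatticeFiltration := X.isLatticeFiltration
  q := X.filtrationProj
  q_surjective := X.filtrationProj_surjective
  q_eq_zero := X.filtrationProj_eq_zero
  q_tr := X.filtrationProj_tr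

theorem clampProj_map {X Y : AdmDiagram k} (g : X ⟶ Y) (j i : ℤ) (l : X.level j) :
    Y.clampProj j i ((((innerLim (discrete k)).map g.hom).app j).hom l) =
      app g (min_le_right i j) (X.clampProj j i l) :=
  congrArg (fun f : X.level j ⟶ _ => f.hom l)
    (limMap_π (Functor.whiskerLeft (clamp.obj j) (Functor.whiskerRight g.hom (discrete k))) i)

theorem map_ofLevel {X Y : AdmDiagram k} (g : X ⟶ Y) (j : ℤ) (l : X.level j) :
    ((colimLim (discrete k) (𝟭 _)).map g.hom).hom ((X.ofLevel j).hom l) =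
      (Y.ofLevel j).hom ((((innerLim (discrete k)).map g.hom).app j).hom l) :=
  congrArg (fun f : X.level j ⟶ _ => f.hom l)
    (ι_colimMap (Functor.whiskerRight ((innerLim (discrete k)).map g.hom) (𝟭 _)) j)

theorem compat_map {X Y : AdmDiagram k} (g : X ⟶ Y) :
    Compat X.model Y.model g ((colimLim (discrete k) (𝟭 _)).map g.hom) where
  map j v hv := by
    obtain ⟨l, rfl⟩ := hv
    exact ⟨_, (map_ofLevel g j l).symm⟩
  q {i j} h v hv := by
    obtain ⟨l, rfl⟩ := hv
    let gl : Y.level j := (((innerLim (discrete k)).map g.hom).app j).hom l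
    calc Y.filtrationProj h ⟨((colimLim (discrete k) (𝟭 _)).map g.hom).hom _, _⟩
        = Y.filtrationProj h ⟨(Y.ofLevel j).hom gl, gl, rfl⟩ :=
          congrArg (Y.filtrationProj h) (Subtype.ext (map_ofLevel g j l))
      _ = Y.proj h gl := Y.filtrationProj_ofLevel h gl _
      _ = app g h (X.proj h l) := by rw [proj_apply, proj_apply, clampProj_map, app_tr]
      _ = _ := congrArg (app g h) (X.filtrationProj_ofLevel h l ⟨l, rfl⟩).symm

end AdmDiagram

end Realization

/-! ### The realization is fully faithful -/

namespace Bicofinal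

/-- The identity reindexing. -/
def refl : Bicofinal := ⟨_root_.id, monotone_id, Filter.tendsto_id, Filter.tendsto_id⟩

/-- Composition of reindexings. -/
def comp (φ ψ : Bicofinal) : Bicofinal :=
  ⟨φ.toFun ∘ ψ.toFun, φ.mono.comp ψ.mono, φ.tendsto_atBot.comp ψ.tendsto_atBot,
    φ.tendsto_atTop.comp ψ.tendsto_atTop⟩

theorem exists_forall_rel (P : ℤ → ℤ → Prop) (antitone_left : ∀ j j' n, j ≤ j' → P j' n → P j n)
    (monotone_right : ∀ j n n', n ≤ n' → P j n → P j n') (exists_right : ∀ j, ∃ n, P j n)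
    (exists_left : ∀ n, ∃ j, P j n) :
    ∃ ψ : Bicofinal, (∀ j, j ≤ ψ.toFun j) ∧ ∀ j, P j (ψ.toFun j) := by
  have exists_least : ∀ j, ∃ n, (j ≤ n ∧ P j n) ∧ ∀ m, (j ≤ m ∧ P j m) → n ≤ m := fun j => by
    obtain ⟨n, hn⟩ := exists_right j
    exact Int.exists_least_of_bdd ⟨j, fun z hz => hz.1⟩
      ⟨max j n, le_max_left _ _, monotone_right j n _ (le_max_right _ _) hn⟩
  choose ψ hψ ψ_le using exists_least
  have ψ_mono : Monotone ψ := fun j j' h =>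
    ψ_le j _ ⟨h.trans (hψ j').1, antitone_left j j' _ h (hψ j').2⟩
  have ψ_atBot : Filter.Tendsto ψ Filter.atBot Filter.atBot :=
    Filter.tendsto_atBot.2 fun n => by
      obtain ⟨j₀, h₀⟩ := exists_left n
      filter_upwards [Filter.eventually_le_atBot j₀, Filter.eventually_le_atBot n] with j hj hn
      exact ψ_le j n ⟨hn, antitone_left _ _ _ hj h₀⟩
  exact ⟨⟨ψ, ψ_mono, ψ_atBot, Filter.tendsto_atTop_mono (fun j => (hψ j).1) Filter.tendsto_id⟩,
    fun j => (hψ j).1, fun j => (hψ j).2⟩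

end Bicofinal

section Fractions

variable {k : Type u} [Field k]

namespace AdmDiagram

/-- The morphism with components `X_{i,j} ⟶ X_{ψ i, ψ j}`. -/
def toReindex (X : AdmDiagram k) (ψ : Bicofinal) (h : ∀ i, i ≤ ψ.toFun i) : X ⟶ X.reindex ψ :=
  X.shift (φ₀ := Bicofinal.refl) h

/-- The morphism with components `g_{φ i, φ j}`. -/
def reindexMap {X Y : AdmDiagram k} (g : X ⟶ Y) (φ : Bicofinal) : X.reindex φ ⟶ Y.reindex φ :=
  ObjectProperty.homMk (Functor.whiskerLeft φ.onPairs g.hom)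

theorem shift_comp_shift (X : AdmDiagram k) {φ₀ φ₁ φ₂ : Bicofinal}
    (h : ∀ i, φ₀.toFun i ≤ φ₁.toFun i) (h' : ∀ i, φ₁.toFun i ≤ φ₂.toFun i) :
    X.shift h ≫ X.shift h' = X.shift fun i => (h i).trans (h' i) :=
  hom_ext fun _ _ hij x =>
    X.tr_tr (φ₀.mono hij) (φ₁.mono hij) (φ₂.mono hij) (h _) (h _) (h' _) (h' _) x

theorem toReindex_naturality {X Y : AdmDiagram k} (g : X ⟶ Y) (ψ : Bicofinal)
    (h : ∀ i, i ≤ ψ.toFun i) : g ≫ Y.toReindex ψ h = X.toReindex ψ h ≫ reindexMap g ψ :=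
  hom_ext fun _ _ hij x => (app_tr g hij (ψ.mono hij) (h _) (h _) x).symm

instance isIso_Q_toReindex (X : AdmDiagram k) (ψ : Bicofinal) (h : ∀ i, i ≤ ψ.toFun i) :
    IsIso ((shiftMaps k).Q.map (X.toReindex ψ h)) :=
  (shiftMaps k).Q_inverts _ (shiftMaps.mk X (φ₀ := Bicofinal.refl) h)

end AdmDiagram

/-- The morphism `h` of Tate spaces is the fraction with numerator `g` and denominator
`Y ⟶ Y.reindex ψ`. -/
def IsFractionOf {X Y : AdmDiagram k} (h : (shiftMaps k).Q.obj X ⟶ (shiftMaps k).Q.obj Y)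
    (ψ : Bicofinal) (g : X ⟶ Y.reindex ψ) : Prop :=
  ∃ hψ : ∀ i, i ≤ ψ.toFun i,
    h ≫ (shiftMaps k).Q.map (Y.toReindex ψ hψ) = (shiftMaps k).Q.map g

theorem IsFractionOf.shift {X Y : AdmDiagram k}
    {h : (shiftMaps k).Q.obj X ⟶ (shiftMaps k).Q.obj Y} {ψ ψ' : Bicofinal} {g : X ⟶ Y.reindex ψ}
    (hg : IsFractionOf h ψ g) (le : ∀ i, ψ.toFun i ≤ ψ'.toFun i) :
    IsFractionOf h ψ' (g ≫ Y.shift le) := by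
  obtain ⟨hψ, eq⟩ := hg
  refine ⟨fun i => (hψ i).trans (le i), ?_⟩
  have hshift : Y.toReindex ψ hψ ≫ Y.shift le = Y.toReindex ψ' _ := Y.shift_comp_shift hψ le
  rw [← hshift, Functor.map_comp, reassoc_of% eq]
  exact ((shiftMaps k).Q.map_comp _ _).symm

theorem IsFractionOf.comp {X Y Z : AdmDiagram k}
    {h : (shiftMaps k).Q.obj X ⟶ (shiftMaps k).Q.obj Y}
    {h' : (shiftMaps k).Q.obj Y ⟶ (shiftMaps k).Q.obj Z} {ψ ψ' : Bicofinal}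
    {g : X ⟶ Y.reindex ψ} {g' : Y ⟶ Z.reindex ψ'} (hg : IsFractionOf h ψ g)
    (hg' : IsFractionOf h' ψ' g') :
    IsFractionOf (h ≫ h') (ψ'.comp ψ) (g ≫ AdmDiagram.reindexMap g' ψ) := by
  obtain ⟨hψ, eq⟩ := hg
  obtain ⟨hψ', eq'⟩ := hg'
  refine ⟨fun i => (hψ i).trans (hψ' _), ?_⟩
  have hshift : Z.toReindex ψ' hψ' ≫ (Z.reindex ψ').toReindex ψ hψ =
      Z.toReindex (ψ'.comp ψ) fun i => (hψ i).trans (hψ' _) :=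
    Z.shift_comp_shift (φ₀ := Bicofinal.refl) (φ₂ := ψ'.comp ψ) hψ' fun i => ψ'.mono (hψ i)
  have eq_comp : (h ≫ h') ≫
      (shiftMaps k).Q.map (Z.toReindex ψ' hψ' ≫ (Z.reindex ψ').toReindex ψ hψ) =
        (shiftMaps k).Q.map (g ≫ AdmDiagram.reindexMap g' ψ) := by
    rw [Functor.map_comp, Category.assoc, reassoc_of% eq', ← Functor.map_comp,
      AdmDiagram.toReindex_naturality, Functor.map_comp, reassoc_of% eq, Functor.map_comp]
  exact (congrArg (fun t => (h ≫ h') ≫ (shiftMaps k).Q.map t) hshift).symm.trans eq_comp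

theorem isFractionOf_map {X Y : AdmDiagram k} (g : X ⟶ Y) :
    IsFractionOf ((shiftMaps k).Q.map g) Bicofinal.refl
      (g ≫ Y.toReindex Bicofinal.refl fun _ => le_rfl) :=
  ⟨fun _ => le_rfl, ((shiftMaps k).Q.map_comp _ _).symm⟩

theorem exists_isFractionOf_inv (X : AdmDiagram k) {φ₀ φ₁ : Bicofinal}
    (h : ∀ i, φ₀.toFun i ≤ φ₁.toFun i) :
    ∃ ψ g, IsFractionOf (X := X.reindex φ₁) (Y := X.reindex φ₀)
      (Localization.Construction.wInv (X.shift h) (shiftMaps.mk X h)) ψ g := by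
  obtain ⟨ψ, hψ, le⟩ := Bicofinal.exists_forall_rel (fun j n => φ₁.toFun j ≤ φ₀.toFun n)
    (fun j j' n hj hn => (φ₁.mono hj).trans hn) (fun j n n' hn hj => hj.trans (φ₀.mono hn))
    (fun j => (φ₀.tendsto_atTop.eventually_ge_atTop _).exists)
    (fun n => (φ₁.tendsto_atBot.eventually_le_atBot _).exists)
  refine ⟨ψ, X.shift (φ₁ := φ₀.comp ψ) le, hψ, ?_⟩
  have hshift : X.shift h ≫ X.shift (φ₁ := φ₀.comp ψ) le = (X.reindex φ₀).toReindex ψ hψ :=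
    X.shift_comp_shift h _
  have eq_comp : Localization.Construction.wInv (X.shift h) (shiftMaps.mk X h) ≫
      (shiftMaps k).Q.map (X.shift h ≫ X.shift (φ₁ := φ₀.comp ψ) le) =
        (shiftMaps k).Q.map (X.shift (φ₁ := φ₀.comp ψ) le) := by
    rw [Functor.map_comp]
    exact (Localization.Construction.wIso (X.shift h) (shiftMaps.mk X h)).inv_hom_id_assoc _
  exact (congrArg (fun t => Localization.Construction.wInv (X.shift h) (shiftMaps.mk X h) ≫
    (shiftMaps k).Q.map t) hshift).symm.trans eq_comp

theorem exists_isFractionOf {X Y : AdmDiagram k}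
    (h : (shiftMaps k).Q.obj X ⟶ (shiftMaps k).Q.obj Y) : ∃ ψ g, IsFractionOf h ψ g := by
  let fractions : MorphismProperty (Tate k) := fun T T' h =>
    ∃ ψ g, IsFractionOf (X := (Localization.Construction.objEquiv _).symm T)
      (Y := (Localization.Construction.objEquiv _).symm T') h ψ g
  have : fractions.IsStableUnderComposition :=
    ⟨fun _ _ ⟨_, _, hg⟩ ⟨_, _, hg'⟩ => ⟨_, _, hg.comp hg'⟩⟩
  have hfractions : fractions = ⊤ := by
    refine Localization.Construction.morphismProperty_eq_top _ (fun X Y f => ?_) ?_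
    · exact ⟨_, _, isFractionOf_map f⟩
    · rintro _ _ _ ⟨X, h⟩
      exact exists_isFractionOf_inv X h
  have : fractions h := by
    rw [hfractions]
    trivial
  exact this

end Fractions

section Realization

theorem exists_le_of_fg_map_mkQ {k V ι : Type*} [Ring k] [AddCommGroup V] [Module k V] [Nonempty ι]
    {P Q : Submodule k V} (h : (P.map Q.mkQ).FG) {T : ι → Submodule k V}
    (hT : Directed (· ≤ ·) T) (hQ : ∀ n, Q ≤ T n) (hP : P ≤ ⨆ n, T n) : ∃ n, P ≤ T n := by
  have hle : P.map Q.mkQ ≤ ⨆ n, (T n).map Q.mkQ := by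
    rw [← Submodule.map_iSup]
    exact Submodule.map_mono hP
  have hmap : Directed (· ≤ ·) fun n => (T n).map Q.mkQ :=
    hT.mono_comp (· ≤ ·) (g := Submodule.map Q.mkQ) fun _ _ => Submodule.map_mono
  obtain ⟨_, ⟨n, rfl⟩, hn⟩ := (Submodule.fg_iff_compact _).1 h _ _ (Set.range_nonempty _)
    hmap.directedOn_range isLUB_iSup hle
  refine ⟨n, (Submodule.map_le_iff_le_comap.1 hn).trans ?_⟩
  rw [Submodule.comap_map_mkQ]
  exact sup_le (hQ n) le_rfl

namespace IsLatticeFiltration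

variable {k V W : Type*} [Field k] [AddCommGroup V] [Module k V] [TopologicalSpace V]
  [AddCommGroup W] [Module k W] [TopologicalSpace W] {F : ℤ → Submodule k V}
  {G : ℤ → Submodule k W}

theorem exists_le_comap_left (hF : IsLatticeFiltration F) (hG : IsLatticeFiltration G)
    (f : V →L[k] W) (n : ℤ) : ∃ j, F j ≤ (G n).comap f.toLinearMap :=
  hF.basis _ <| f.continuous.continuousAt.preimage_mem_nhds <| by
    rw [map_zero]
    exact (hG.isOpen n).mem_nhds (G n).zero_mem

theorem exists_le_comap_right (hF : IsLatticeFiltration F) (hG : IsLatticeFiltration G)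
    (f : V →L[k] W) (j : ℤ) : ∃ n, F j ≤ (G n).comap f.toLinearMap := by
  obtain ⟨i, hi⟩ := hF.exists_le_comap_left hG f 0
  have hmono : Monotone fun n : ℕ => (G n).comap f.toLinearMap := fun n n' h =>
    Submodule.comap_mono (hG.mono (by exact_mod_cast h))
  obtain ⟨n, hn⟩ := exists_le_of_fg_map_mkQ (hF.finite i j) hmono.directed_le
    (fun n => hi.trans (hmono n.zero_le)) fun v _ => by
      obtain ⟨n, hn⟩ := hG.exhaust_nat (f v)
      exact Submodule.mem_iSup_of_mem n hn
  exact ⟨n, hn⟩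

theorem exists_bicofinal (hF : IsLatticeFiltration F) (hG : IsLatticeFiltration G)
    (f : V →L[k] W) : ∃ ψ : Bicofinal, (∀ j, j ≤ ψ.toFun j) ∧
      ∀ j, F j ≤ (G (ψ.toFun j)).comap f.toLinearMap :=
  Bicofinal.exists_forall_rel (fun j n => F j ≤ (G n).comap f.toLinearMap)
    (fun _ _ _ hj => (hF.mono hj).trans)
    (fun _ _ _ hn hj => hj.trans (Submodule.comap_mono (hG.mono hn)))
    (hF.exists_le_comap_right hG f) (hF.exists_le_comap_left hG f)

end IsLatticeFiltration

variable {k : Type u} [Field k] [TopologicalSpace k] {X Y : AdmDiagram k} {V W : TopModuleCat.{u} k}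

namespace Model

theorem compat_toReindex (M : Model X V) (ψ : Bicofinal) (h : ∀ i, i ≤ ψ.toFun i) :
    Compat M (M.reindex ψ) (X.toReindex ψ h) (𝟙 V) where
  map j _ hv := M.mono (h j) hv
  q h' v hv := M.q_tr h' (ψ.mono h') (h _) (h _) v hv

/-- Transport of a model along an isomorphism. -/
def ofIso (M : Model X V) (e : V ≅ W) : Model X W where
  F j := (M.F j).comap e.inv.hom.toLinearMap
  isLatticeFiltration := M.isLatticeFiltration.comap _
    e.toContinuousLinearEquiv.symm.toHomeomorph.isClosedEmbedding
  q h := M.q h ∘ₗ e.inv.hom.toLinearMap.restrict fun _ hv => hv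
  q_surjective h := (M.q_surjective h).comp fun v =>
    ⟨⟨e.hom.hom v, by simp⟩, Subtype.ext (by simp)⟩
  q_eq_zero h v := M.q_eq_zero h ⟨e.inv.hom v, v.2⟩
  q_tr h h' a b v hv := M.q_tr h h' a b (e.inv.hom v) hv

end Model

variable [DiscreteTopology k]

/-- The canonical model of `X`, on the space `Φ(X)`. -/
def realizationModel (X : AdmDiagram k) : Model X ((realization k).obj ((shiftMaps k).Q.obj X)) :=
  X.model

theorem compat_realization_map (g : X ⟶ Y) : Compat (realizationModel X) (realizationModel Y) g
    ((realization k).map ((shiftMaps k).Q.map g)) :=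
  AdmDiagram.compat_map g

theorem realization_map_injective {h h' : (shiftMaps k).Q.obj X ⟶ (shiftMaps k).Q.obj Y}
    (eq : (realization k).map h = (realization k).map h') : h = h' := by
  obtain ⟨ψ₁, g₁, hg₁⟩ := exists_isFractionOf h
  obtain ⟨ψ₂, g₂, hg₂⟩ := exists_isFractionOf h'
  have le₁ : ∀ i, ψ₁.toFun i ≤ (ψ₁.comp ψ₂).toFun i := fun i => ψ₁.mono (hg₂.1 i)
  have le₂ : ∀ i, ψ₂.toFun i ≤ (ψ₁.comp ψ₂).toFun i := fun i => hg₁.1 _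
  obtain ⟨_, eq₁⟩ := hg₁.shift le₁
  obtain ⟨_, eq₂⟩ := hg₂.shift le₂
  have c₁ := compat_realization_map (g₁ ≫ Y.shift le₁)
  have c₂ := compat_realization_map (g₂ ≫ Y.shift le₂)
  rw [← eq₁, Functor.map_comp, eq, ← Functor.map_comp, eq₂] at c₁
  rw [c₁.diagram_hom_unique c₂, ← eq₂] at eq₁
  exact (cancel_mono _).1 eq₁

instance realization_faithful : (realization k).Faithful where
  map_injective {T T'} _ _ eq := by
    obtain ⟨X, rfl⟩ := (Localization.Construction.objEquiv _).surjective T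
    obtain ⟨Y, rfl⟩ := (Localization.Construction.objEquiv _).surjective T'
    exact realization_map_injective eq

theorem exists_realization_map_eq (f : (realization k).obj ((shiftMaps k).Q.obj X) ⟶
      (realization k).obj ((shiftMaps k).Q.obj Y)) :
    ∃ h : (shiftMaps k).Q.obj X ⟶ (shiftMaps k).Q.obj Y, (realization k).map h = f := by
  obtain ⟨ψ, hψ, hf⟩ := (realizationModel X).isLatticeFiltration.exists_bicofinal
    (realizationModel Y).isLatticeFiltration f.hom
  let N : Model (Y.reindex ψ) ((realization k).obj ((shiftMaps k).Q.obj Y)) :=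
    (realizationModel Y).reindex ψ
  obtain ⟨g, hg⟩ := (realizationModel X).exists_compat_diagram N f fun j _ hv => hf j hv
  obtain ⟨e, he⟩ := exists_compat_iso N (realizationModel (Y.reindex ψ))
  have map_g : (realization k).map ((shiftMaps k).Q.map g) = f ≫ e.hom := by
    refine (compat_realization_map g).hom_unique ?_
    simpa only [Category.comp_id] using hg.comp he
  have map_toReindex :
      (realization k).map ((shiftMaps k).Q.map (Y.toReindex ψ hψ)) = e.hom := by
    refine (compat_realization_map (Y.toReindex ψ hψ)).hom_unique ?_
    simpa only [Category.comp_id, Category.id_comp] using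
      ((realizationModel Y).compat_toReindex ψ hψ).comp he
  refine ⟨(shiftMaps k).Q.map g ≫ inv ((shiftMaps k).Q.map (Y.toReindex ψ hψ)), ?_⟩
  rw [Functor.map_comp, Functor.map_inv, IsIso.comp_inv_eq, map_g, map_toReindex]

instance realization_full : (realization k).Full where
  map_surjective {T T'} f := by
    obtain ⟨X, rfl⟩ := (Localization.Construction.objEquiv _).surjective T
    obtain ⟨Y, rfl⟩ := (Localization.Construction.objEquiv _).surjective T'
    exact exists_realization_map_eq f

theorem realization_essImage_iff (V : TopModuleCat.{u} k) :
    (realization k).essImage V ↔ ∃ X : AdmDiagram k, Nonempty (Model X V) := by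
  constructor
  · rintro ⟨T, ⟨e⟩⟩
    obtain ⟨X, rfl⟩ := (Localization.Construction.objEquiv _).surjective T
    exact ⟨X, ⟨(realizationModel X).ofIso e⟩⟩
  · rintro ⟨X, ⟨M⟩⟩
    obtain ⟨e, -⟩ := exists_compat_iso (realizationModel X) M
    exact ⟨(shiftMaps k).Q.obj X, ⟨e⟩⟩

theorem realization_essImage_iff_isCountableLLC (V : TopModuleCat.{u} k) :
    (realization k).essImage V ↔ IsCountableLLC k V := by
  rw [realization_essImage_iff, exists_isLatticeFiltration_iff]
  exact ⟨fun ⟨_, ⟨M⟩⟩ => ⟨M.F, M.isLatticeFiltration⟩, fun ⟨_, hF⟩ => ⟨_, ⟨hF.model⟩⟩⟩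

end Realization

/-! ### Exactness of the passage to ind-pro-objects -/

theorem preservesColimitsOfShape_indInclusion (C : Type*) [Category.{u} C] (J : Type)
    [SmallCategory J] [IsFiltered J] : PreservesColimitsOfShape J (Ind.inclusion C) := by
  have : PreservesFilteredColimitsOfSize.{u, u} (Ind.inclusion C) := ⟨fun _ _ _ => inferInstance⟩
  have := preservesSmallestFilteredColimits_of_preservesFilteredColimits.{u, u} (Ind.inclusion C)
  infer_instance

theorem hasExactColimitsOfShape_of_ab5OfSize (C : Type*) [Category* C]
    [HasFilteredColimitsOfSize.{u, u} C] [AB5OfSize.{u, u} C] (J : Type) [SmallCategory J]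
    [IsFiltered J] [HasColimitsOfShape J C] : HasExactColimitsOfShape J C :=
  have := hasFilteredColimitsOfSize_of_univLE.{0, 0, u, u} (C := C)
  (AB5OfSize_of_univLE.{0, 0, u, u} C).ofShape J

theorem hasExactLimitsOfShape_op (C : Type*) [Category* C] (J : Type*) [Category* J]
    [HasColimitsOfShape Jᵒᵖ C] [HasExactColimitsOfShape Jᵒᵖ C] [HasLimitsOfShape J Cᵒᵖ] :
    HasExactLimitsOfShape J Cᵒᵖ := by
  let e := Functor.leftOpRightOpEquiv J C
  have adj : (Functor.const Jᵒᵖ : C ⥤ _).op ⋙ e.functor ⊣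
      e.inverse ⋙ (colim : (Jᵒᵖ ⥤ C) ⥤ C).op := (colimConstAdj.op).comp e.toAdjunction
  have i : (Functor.const Jᵒᵖ : C ⥤ _).op ⋙ e.functor ≅ Functor.const J :=
    NatIso.ofComponents
      (fun X => NatIso.ofComponents (fun j => Iso.refl _)
        fun _ => (Category.comp_id _).trans (Category.id_comp _).symm)
      fun _ => by
        ext
        exact (Category.comp_id _).trans (Category.id_comp _).symm
  have i' : e.inverse ⋙ (colim : (Jᵒᵖ ⥤ C) ⥤ C).op ≅ lim :=
    (adj.ofNatIsoLeft i).rightAdjointUniq constLimAdj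
  have : PreservesFiniteColimits (colim : (Jᵒᵖ ⥤ C) ⥤ C).op := preservesFiniteColimits_op _
  have : PreservesFiniteColimits e.inverse := inferInstance
  have := comp_preservesFiniteColimits e.inverse (colim : (Jᵒᵖ ⥤ C) ⥤ C).op
  exact ⟨preservesFiniteColimits_of_natIso i'⟩

variable (k : Type u) [Field k]

instance : HasExactColimitsOfShape ℤ (IndPro k) :=
  hasExactColimitsOfShape_of_ab5OfSize.{u} _ ℤ

instance : HasExactLimitsOfShape ℤ (Pro (FGModuleCat.{u} k)) := by
  have : HasColimitsOfShape ℤᵒᵖ (Ind (FGModuleCat.{u} k)ᵒᵖ) := hasColimitsOfShape_of_isFiltered ℤᵒᵖ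
  have := hasExactColimitsOfShape_of_ab5OfSize.{u} (Ind (FGModuleCat.{u} k)ᵒᵖ) ℤᵒᵖ
  exact hasExactLimitsOfShape_op _ ℤ

section
universe v₁ v₂ v₃ u₁ u₂ u₃
variable {A : Type u₁} [Category.{v₁} A] {D : Type u₂} [Category.{v₂} D]
  {D' : Type u₃} [Category.{v₃} D'] [HasLimitsOfShape ℤ D] [HasColimitsOfShape ℤ D']

/-- Evaluating `innerLim F` at `j`. -/
def innerLimCompEvaluation (F : A ⥤ D) (j : ℤ) :
    innerLim F ⋙ (evaluation ℤ D).obj j ≅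
      (Functor.whiskeringRight Pairs A D).obj F ⋙
        (Functor.whiskeringLeft ℤ Pairs D).obj (clamp.obj j) ⋙ lim :=
  NatIso.ofComponents (fun _ => Iso.refl _)
    fun _ => (Category.comp_id _).trans (Category.id_comp _).symm

theorem preservesFiniteLimits_innerLim (F : A ⥤ D) [PreservesFiniteLimits F] [HasFiniteLimits A]
    [HasFiniteLimits D] : PreservesFiniteLimits (innerLim F) where
  preservesFiniteLimits K _ _ := by
    refine preservesLimitsOfShape_of_evaluation _ K fun j => ?_
    have : PreservesLimitsOfShape K (lim : (ℤ ⥤ D) ⥤ D) := inferInstance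
    exact preservesLimitsOfShape_of_natIso (innerLimCompEvaluation F j).symm

theorem preservesFiniteColimits_innerLim (F : A ⥤ D) [PreservesFiniteColimits F]
    [HasFiniteColimits A] [HasFiniteColimits D] [HasExactLimitsOfShape ℤ D] :
    PreservesFiniteColimits (innerLim F) where
  preservesFiniteColimits K _ _ := by
    refine preservesColimitsOfShape_of_evaluation _ K fun j => ?_
    have : PreservesColimitsOfShape K (lim : (ℤ ⥤ D) ⥤ D) := inferInstance
    exact preservesColimitsOfShape_of_natIso (innerLimCompEvaluation F j).symm

theorem preservesFiniteLimits_colimLim (F : A ⥤ D) (G : D ⥤ D') [PreservesFiniteLimits F]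
    [PreservesFiniteLimits G] [HasFiniteLimits A] [HasFiniteLimits D]
    [HasExactColimitsOfShape ℤ D'] : PreservesFiniteLimits (colimLim F G) := by
  have := preservesFiniteLimits_innerLim F
  have : PreservesFiniteLimits ((Functor.whiskeringRight ℤ D D').obj G) :=
    ⟨fun K _ _ => inferInstance⟩
  have := comp_preservesFiniteLimits ((Functor.whiskeringRight ℤ D D').obj G) colim
  exact comp_preservesFiniteLimits (innerLim F) ((Functor.whiskeringRight ℤ D D').obj G ⋙ colim)

theorem preservesFiniteColimits_colimLim (F : A ⥤ D) (G : D ⥤ D') [PreservesFiniteColimits F]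
    [PreservesFiniteColimits G] [HasFiniteColimits A] [HasFiniteColimits D]
    [HasExactLimitsOfShape ℤ D] : PreservesFiniteColimits (colimLim F G) := by
  have := preservesFiniteColimits_innerLim F
  have : PreservesFiniteColimits ((Functor.whiskeringRight ℤ D D').obj G) :=
    ⟨fun K _ _ => inferInstance⟩
  have : PreservesFiniteColimits (colim : (ℤ ⥤ D') ⥤ D') := ⟨fun K _ _ => inferInstance⟩
  have := comp_preservesFiniteColimits ((Functor.whiskeringRight ℤ D D').obj G) colim
  exact comp_preservesFiniteColimits (innerLim F) ((Functor.whiskeringRight ℤ D D').obj G ⋙ colim)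

end

/-- The functor `X ↦ "colim"_j "lim"_i X_{i,j}` on arbitrary diagrams. -/
abbrev indProLim : (Pairs ⥤ FGModuleCat.{u} k) ⥤ IndPro k :=
  colimLim (Ind.yoneda (C := (FGModuleCat.{u} k)ᵒᵖ)).rightOp Ind.yoneda

instance : PreservesFiniteLimits (indProLim k) := by
  have : PreservesFiniteLimits (Ind.yoneda (C := (FGModuleCat.{u} k)ᵒᵖ)).rightOp :=
    preservesFiniteLimits_rightOp _
  have : HasFiniteLimits (Pro (FGModuleCat.{u} k)) := hasFiniteLimits_opposite
  have : PreservesFiniteLimits (Ind.yoneda (C := Pro (FGModuleCat.{u} k))) :=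
    PreservesLimits.preservesFiniteLimits _
  exact preservesFiniteLimits_colimLim _ _

instance : PreservesFiniteColimits (indProLim k) := by
  have : PreservesFiniteLimits (Ind.yoneda (C := (FGModuleCat.{u} k)ᵒᵖ)) :=
    PreservesLimits.preservesFiniteLimits _
  have : PreservesFiniteColimits (Ind.yoneda (C := (FGModuleCat.{u} k)ᵒᵖ)).rightOp :=
    preservesFiniteColimits_rightOp _
  exact preservesFiniteColimits_colimLim _ _

/-! ### Points of ind-pro-objects -/

section
universe v₁ v₂ v₃ v₄ u₁ u₂ u₃ u₄
variable {A : Type u₁} [Category.{v₁} A] {D : Type u₂} [Category.{v₂} D]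
  {D' : Type u₃} [Category.{v₃} D'] {E : Type u₄} [Category.{v₄} E]

/-- `innerLim` commutes with functors preserving limits. -/
def innerLimComp [HasLimitsOfShape ℤ D] [HasLimitsOfShape ℤ E] (F : A ⥤ D) (K : D ⥤ E)
    [PreservesLimitsOfShape ℤ K] :
    innerLim F ⋙ (Functor.whiskeringRight ℤ D E).obj K ≅ innerLim (F ⋙ K) :=
  NatIso.ofComponents
    (fun X => Functor.isoWhiskerLeft (clamp ⋙ (Functor.whiskeringRight ℤ Pairs D).obj (X ⋙ F))
      (preservesLimitNatIso K))
    fun f => by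
      ext j
      exact (preservesLimitNatIso K).hom.naturality
        (Functor.whiskerLeft (clamp.obj j) (Functor.whiskerRight f F))

/-- `innerLim` depends on `F` only up to isomorphism. -/
def innerLimCongr [HasLimitsOfShape ℤ D] {F F' : A ⥤ D} (e : F ≅ F') : innerLim F ≅ innerLim F' :=
  NatIso.ofComponents
    (fun X => NatIso.ofComponents (fun j => lim.mapIso
      (Functor.isoWhiskerLeft (clamp.obj j) (Functor.isoWhiskerLeft X e)))
      fun f => by
        refine (lim.map_comp _ _).symm.trans (Eq.trans (congrArg _ ?_) (lim.map_comp _ _))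
        ext i
        exact e.hom.naturality _)
    fun f => by
      ext j : 2
      refine (lim.map_comp _ _).symm.trans (Eq.trans (congrArg _ ?_) (lim.map_comp _ _))
      ext i
      exact e.hom.naturality _

/-- `colimLim` commutes with functors preserving colimits. -/
def colimLimComp [HasLimitsOfShape ℤ D] [HasColimitsOfShape ℤ D'] [HasColimitsOfShape ℤ E]
    (F : A ⥤ D) (G : D ⥤ D') (K : D' ⥤ E) [PreservesColimitsOfShape ℤ K] :
    colimLim F G ⋙ K ≅ colimLim F (G ⋙ K) :=
  Functor.isoWhiskerLeft (innerLim F ⋙ (Functor.whiskeringRight ℤ D D').obj G)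
      (preservesColimitNatIso K)

/-- A limit-preserving functor can be moved inside the limit. -/
def colimLimAssoc [HasLimitsOfShape ℤ D] [HasLimitsOfShape ℤ D'] [HasColimitsOfShape ℤ E]
    (F : A ⥤ D) (G : D ⥤ D') (K : D' ⥤ E) [PreservesLimitsOfShape ℤ G] :
    colimLim F (G ⋙ K) ≅ colimLim (F ⋙ G) K :=
  Functor.isoWhiskerRight (innerLimComp F G) ((Functor.whiskeringRight ℤ D' E).obj K ⋙ colim)

/-- `colimLim F G` depends on `F` and `G` only up to isomorphism. -/
def colimLimCongr [HasLimitsOfShape ℤ D] [HasColimitsOfShape ℤ D']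
    {F F' : A ⥤ D} {G G' : D ⥤ D'} (e : F ≅ F') (e' : G ≅ G') :
    colimLim F G ≅ colimLim F' G' :=
  Functor.isoWhiskerRight (innerLimCongr e) ((Functor.whiskeringRight ℤ D D').obj G ⋙ colim) ≪≫
    Functor.isoWhiskerLeft (innerLim F')
      (Functor.isoWhiskerRight ((Functor.whiskeringRight ℤ D D').mapIso e') colim)

end

/-- The line, as a pro-object. -/
abbrev proLine : Pro (FGModuleCat.{u} k) :=
  (Ind.yoneda (C := (FGModuleCat.{u} k)ᵒᵖ)).rightOp.obj (FGModuleCat.of k k)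

/-- The underlying set of an ind-pro-object, the set of its maps from the line. -/
def IndPro.points : IndPro k ⥤ Type u :=
  Ind.inclusion (Pro (FGModuleCat.{u} k)) ⋙ (evaluation _ _).obj (Opposite.op (proLine k))

instance : PreservesFiniteLimits (IndPro.points k) := by
  have : HasFiniteLimits (Pro (FGModuleCat.{u} k)) := hasFiniteLimits_opposite
  have h : PreservesFiniteLimits ((evaluation (Pro (FGModuleCat.{u} k))ᵒᵖ (Type u)).obj
    (Opposite.op (proLine k))) := ⟨fun _ _ _ => inferInstance⟩
  exact comp_preservesFiniteLimits _ _

instance : PreservesColimitsOfShape ℤ (IndPro.points k) := by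
  have : PreservesColimitsOfShape ℤ ((evaluation (Pro (FGModuleCat.{u} k))ᵒᵖ (Type u)).obj
    (Opposite.op (proLine k))) := inferInstance
  have := preservesColimitsOfShape_indInclusion (Pro (FGModuleCat.{u} k)) ℤ
  exact comp_preservesColimitsOfShape _ _

/-- The underlying set of a pro-object. -/
abbrev Pro.points : Pro (FGModuleCat.{u} k) ⥤ Type u := coyoneda.obj (Opposite.op (proLine k))

/-- The points of the ind-object of a pro-object. -/
def yonedaCompPoints : Ind.yoneda ⋙ IndPro.points k ≅ Pro.points k :=
  Functor.isoWhiskerRight Ind.yonedaCompInclusion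
    ((evaluation _ _).obj (Opposite.op (proLine k)))

/-- Maps from the line to `V` are elements of `V`. -/
def lineHomEquiv (V : FGModuleCat.{u} k) : (FGModuleCat.of k k ⟶ V) ≃ V where
  toFun f := f.hom.hom (1 : k)
  invFun v := FGModuleCat.ofHom (LinearMap.toSpanSingleton k V v)
  left_inv _ := FGModuleCat.hom_ext (LinearMap.ext_ring (one_smul k _))
  right_inv := one_smul k

/-- The line represents the forgetful functor. -/
def forgetIsoCoyonedaLine :
    forget (FGModuleCat.{u} k) ≅ coyoneda.obj (Opposite.op (FGModuleCat.of k k)) :=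
  (NatIso.ofComponents (fun V => (lineHomEquiv k V).toIso) fun _ => rfl).symm

/-- A fully faithful functor identifies the functor represented by `X` with the restriction of the
functor represented by the image of `X`. -/
def coyonedaIsoComp {C D : Type*} [Category.{u} C] [Category.{u} D] {F : C ⥤ D}
    (hF : F.FullyFaithful) (X : C) :
    coyoneda.obj (Opposite.op X) ≅ F ⋙ coyoneda.obj (Opposite.op (F.obj X)) :=
  NatIso.ofComponents (fun _ => hF.homEquiv.toIso) fun f => by
    ext g
    exact F.map_comp g f

/-- The inclusion of finite-dimensional vector spaces into pro-objects. -/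
abbrev proYoneda : FGModuleCat.{u} k ⥤ Pro (FGModuleCat.{u} k) :=
  (Ind.yoneda (C := (FGModuleCat.{u} k)ᵒᵖ)).rightOp

/-- The points of a finite-dimensional vector space, as a pro-object, are its elements. -/
def proYonedaCompPoints : forget (FGModuleCat.{u} k) ≅ proYoneda k ⋙ Pro.points k :=
  forgetIsoCoyonedaLine k ≪≫
    coyonedaIsoComp (Functor.FullyFaithful.ofFullyFaithful (proYoneda k)) (FGModuleCat.of k k)

/-- The points of the ind-pro-object of a diagram. -/
def indProLimCompPoints :
    indProLim k ⋙ IndPro.points k ≅ colimLim (forget (FGModuleCat.{u} k)) (𝟭 (Type u)) :=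
  colimLimComp (proYoneda k) Ind.yoneda (IndPro.points k) ≪≫
    colimLimCongr (Iso.refl (proYoneda k))
      (yonedaCompPoints k ≪≫ (Functor.rightUnitor (Pro.points k)).symm) ≪≫
    colimLimAssoc (proYoneda k) (Pro.points k) (𝟭 (Type u)) ≪≫
    colimLimCongr (proYonedaCompPoints k).symm (Iso.refl (𝟭 (Type u)))

theorem Q_comp_toIndPro : (shiftMaps k).Q ⋙ toIndPro k = (IsAdmissible k).ι ⋙ indProLim k :=
  Localization.Construction.fac _ _

variable [TopologicalSpace k]

variable [DiscreteTopology k]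

/-- The underlying set of the realization of a diagram. -/
def colimLimDiscreteCompForget :
    colimLim (discrete k) (𝟭 (TopModuleCat.{u} k)) ⋙ forgetTop k ≅
      colimLim (forget (FGModuleCat.{u} k)) (𝟭 (Type u)) :=
  colimLimComp (discrete k) (𝟭 _) (forgetTop k) ≪≫
    colimLimCongr (Iso.refl (discrete k)) (Functor.leftUnitor (forgetTop k) ≪≫
      (Functor.rightUnitor (forgetTop k)).symm) ≪≫
    colimLimAssoc (discrete k) (forgetTop k) (𝟭 (Type u)) ≪≫
    colimLimCongr (Iso.refl _ : discrete k ⋙ forgetTop k ≅ forget (FGModuleCat.{u} k))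
      (Iso.refl (𝟭 (Type u)))

theorem Q_comp_realization :
    (shiftMaps k).Q ⋙ realization k = (IsAdmissible k).ι ⋙ colimLim (discrete k) (𝟭 _) :=
  Localization.Construction.fac _ _

/-- The points of the ind-pro-object of a Tate space are the points of its realization. -/
def toIndProCompPoints : toIndPro k ⋙ IndPro.points k ≅ realization k ⋙ forgetTop k :=
  let L₁ := (IsAdmissible k).ι ⋙ indProLim k ⋙ IndPro.points k
  let L₂ := (IsAdmissible k).ι ⋙ colimLim (discrete k) (𝟭 _) ⋙ forgetTop k
  have : Localization.Lifting (shiftMaps k).Q (shiftMaps k) L₁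
      (toIndPro k ⋙ IndPro.points k) :=
    ⟨Functor.isoWhiskerRight (eqToIso (Q_comp_toIndPro k)) (IndPro.points k)⟩
  have : Localization.Lifting (shiftMaps k).Q (shiftMaps k) L₂
      (realization k ⋙ forgetTop k) :=
    ⟨Functor.isoWhiskerRight (eqToIso (Q_comp_realization k)) (forgetTop k)⟩
  Localization.liftNatIso (shiftMaps k).Q (shiftMaps k) L₁ L₂ _ _
    (Functor.isoWhiskerLeft (IsAdmissible k).ι
      (indProLimCompPoints k ≪≫ (colimLimDiscreteCompForget k).symm))

/-! ### Short exact sequences of diagrams -/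

section ShortExact

variable {C : Type*} [Category* C] [Preadditive C] [Balanced C] {S : ShortComplex C} {O : C}

theorem isPullback_of_shortExact (hS : S.ShortExact) (hO : IsZero O) (s : S.X₁ ⟶ O)
    (t : O ⟶ S.X₃) : IsPullback S.f s S.g t := by
  obtain rfl : t = 0 := hO.eq_of_src _ _
  have := hS.mono_f
  exact ⟨⟨S.zero.trans comp_zero.symm⟩, ⟨PullbackCone.IsLimit.mk _
    (fun c => hS.exact.lift c.fst (c.condition.trans comp_zero)) (fun c => hS.exact.lift_f _ _)
    (fun c => hO.eq_of_tgt _ _)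
    fun c m hm _ => (cancel_mono S.f).1 (hm.trans (hS.exact.lift_f _ _).symm)⟩⟩

theorem isPushout_of_shortExact (hS : S.ShortExact) (hO : IsZero O) (s : S.X₁ ⟶ O)
    (t : O ⟶ S.X₃) : IsPushout S.f s S.g t := by
  obtain rfl : s = 0 := hO.eq_of_tgt _ _
  have := hS.epi_g
  exact ⟨⟨S.zero.trans zero_comp.symm⟩, ⟨PushoutCocone.IsColimit.mk _
    (fun c => hS.exact.desc c.inl (c.condition.trans zero_comp)) (fun c => hS.exact.g_desc _ _)
    (fun c => hO.eq_of_src _ _)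
    fun c m hm _ => (cancel_epi S.g).1 (hm.trans (hS.exact.g_desc _ _).symm)⟩⟩

end ShortExact

theorem isZero_obj_of_isZero {C D : Type*} [Category* C] [Category* D] (F : C ⥤ D)
    [PreservesFiniteLimits F] [PreservesFiniteColimits F] {O : C} (hO : IsZero O) :
    IsZero (F.obj O) where
  unique_to Y :=
    let h := hO.isInitial.isInitialObj F
    ⟨⟨⟨h.to Y⟩, fun _ => h.hom_ext _ _⟩⟩
  unique_from Y :=
    let h := hO.isTerminal.isTerminalObj F
    ⟨⟨⟨h.from Y⟩, fun _ => h.hom_ext _ _⟩⟩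

section Diagrams

variable {k : Type u} [Field k]

theorem shortExact_fgModuleCat (S : ShortComplex (FGModuleCat.{u} k))
    (inj : Function.Injective S.f.hom.hom) (ex : Function.Exact S.f.hom.hom S.g.hom.hom)
    (surj : Function.Surjective S.g.hom.hom) : S.ShortExact where
  exact := (S.exact_map_iff_of_faithful (forget₂ (FGModuleCat.{u} k) (ModuleCat.{u} k))).1
    (ModuleCat.shortComplex_exact _ ex)
  mono_f := ConcreteCategory.mono_of_injective _ inj
  epi_g := ConcreteCategory.epi_of_surjective _ surj

theorem toIndPro_map_Q {X Y : AdmDiagram k} (g : X ⟶ Y) :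
    (toIndPro k).map ((shiftMaps k).Q.map g) = (indProLim k).map g.hom :=
  Category.id_comp _

theorem tate_isAdmissibleExact_of_app {X Y Z : AdmDiagram k} (g : X ⟶ Y) (g' : Y ⟶ Z)
    (inj : ∀ {i j : ℤ} (h : i ≤ j), Function.Injective (AdmDiagram.app g h))
    (ex : ∀ {i j : ℤ} (h : i ≤ j), Function.Exact (AdmDiagram.app g h) (AdmDiagram.app g' h))
    (surj : ∀ {i j : ℤ} (h : i ≤ j), Function.Surjective (AdmDiagram.app g' h)) :
    Tate.IsAdmissibleExact k ((shiftMaps k).Q.map g) ((shiftMaps k).Q.map g') := by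
  have comp_app (p : Pairs) : g.hom.app p ≫ g'.hom.app p = 0 :=
    FGModuleCat.hom_ext (ex p.2).linearMap_comp_eq_zero
  have shortExact (p : Pairs) : (ShortComplex.mk _ _ (comp_app p)).ShortExact :=
    shortExact_fgModuleCat _ (inj p.2) (ex p.2) (surj p.2)
  obtain ⟨O, hO⟩ := HasZeroObject.zero (C := Pairs ⥤ FGModuleCat.{u} k)
  have pullback : IsPullback g.hom (0 : X.obj ⟶ O) g'.hom 0 :=
    IsPullback.of_forall_isPullback_app fun p =>
      isPullback_of_shortExact (shortExact p) (hO.obj p) _ _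
  have pushout : IsPushout g.hom (0 : X.obj ⟶ O) g'.hom 0 :=
    IsPushout.of_forall_isPushout_app fun p =>
      isPushout_of_shortExact (shortExact p) (hO.obj p) _ _
  rw [Tate.IsAdmissibleExact, toIndPro_map_Q, toIndPro_map_Q]
  exact ⟨_, isZero_obj_of_isZero (indProLim k) hO, _, _, pullback.map (indProLim k),
    pushout.map (indProLim k)⟩

variable [TopologicalSpace k] {X Y Z : AdmDiagram k} {V W U : TopModuleCat.{u} k} {M : Model X V}
  {N : Model Y W} {P : Model Z U} {g : X ⟶ Y} {g' : Y ⟶ Z} {f : V ⟶ W} {f' : W ⟶ U}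

theorem Compat.app_injective (c : Compat M N g f) {i j : ℤ} (h : i ≤ j)
    (hf : ∀ v, f.hom v ∈ N.F i → v ∈ M.F i) : Function.Injective (AdmDiagram.app g h) := by
  refine (injective_iff_map_eq_zero _).2 fun x hx => ?_
  obtain ⟨⟨v, hv⟩, rfl⟩ := M.q_surjective h x
  rw [← c.q h v hv, N.q_eq_zero] at hx
  exact (M.q_eq_zero h _).2 (hf v hx)

theorem Compat.app_surjective (c : Compat M N g f) {i j : ℤ} (h : i ≤ j)
    (hf : ∀ w ∈ N.F j, ∃ v ∈ M.F j, f.hom v = w) : Function.Surjective (AdmDiagram.app g h) := by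
  intro y
  obtain ⟨⟨w, hw⟩, rfl⟩ := N.q_surjective h y
  obtain ⟨v, hv, rfl⟩ := hf w hw
  exact ⟨M.q h ⟨v, hv⟩, (c.q h v hv).symm⟩

theorem Compat.app_exact (c : Compat M N g f) (c' : Compat N P g' f')
    (hex : Function.Exact f.hom f'.hom) {i j : ℤ} (h : i ≤ j)
    (hf : ∀ v, f.hom v ∈ N.F j → v ∈ M.F j) (hf' : ∀ u ∈ P.F i, ∃ w ∈ N.F i, f'.hom w = u) :
    Function.Exact (AdmDiagram.app g h) (AdmDiagram.app g' h) := by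
  intro y
  obtain ⟨⟨w, hw⟩, rfl⟩ := N.q_surjective h y
  rw [← c'.q h w hw, P.q_eq_zero]
  constructor
  · intro hw'
    obtain ⟨w', hw'i, e⟩ := hf' _ hw'
    obtain ⟨v, hv⟩ := (hex (w - w')).1 (by rw [map_sub, e, sub_self])
    have hvj : v ∈ M.F j := hf v (hv ▸ sub_mem hw (N.mono h hw'i))
    refine ⟨M.q h ⟨v, hvj⟩, ?_⟩
    rw [← c.q h v hvj, N.q_eq_q_iff]
    simpa only [hv, sub_sub_cancel_left, neg_mem_iff] using hw'i
  · rintro ⟨x, hx⟩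
    obtain ⟨⟨v, hv⟩, rfl⟩ := M.q_surjective h x
    rw [← c.q h v hv, N.q_eq_q_iff] at hx
    have := c'.map i _ hx
    rwa [map_sub, hex.apply_apply_eq_zero, zero_sub, neg_mem_iff] at this

variable [DiscreteTopology k]

theorem isAdmissibleExact_of_compat (c : Compat M N g f) (c' : Compat N P g' f')
    (h : Tate.IsAdmissibleExact k ((shiftMaps k).Q.map g) ((shiftMaps k).Q.map g')) :
    IsAdmissibleExact f f' := by
  obtain ⟨eV, hV⟩ := exists_compat_iso (realizationModel _) M
  obtain ⟨eW, hW⟩ := exists_compat_iso (realizationModel _) N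
  obtain ⟨eU, hU⟩ := exists_compat_iso (realizationModel _) P
  refine ⟨_, _, _, _, _, h, eV, eW, eU, ?_, ?_⟩
  · have := (compat_realization_map g).comp hW
    rw [Category.comp_id, ← Category.id_comp g] at this
    exact this.hom_unique (hV.comp c)
  · have := (compat_realization_map g').comp hU
    rw [Category.comp_id, ← Category.id_comp g'] at this
    exact this.hom_unique (hW.comp c')

theorem isAdmissibleExact_of_exact {A B C : TopModuleCat.{u} k} {i : A ⟶ B} {p : B ⟶ C}
    (hB : IsCountableLLC k B) (hi : Topology.IsClosedEmbedding i.hom)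
    (hp : IsOpenQuotientMap p.hom) (hex : Function.Exact i.hom p.hom) :
    IsAdmissibleExact i p := by
  obtain ⟨F, hF⟩ := (exists_isLatticeFiltration_iff B).1 hB
  have ker_eq : (LinearMap.ker p.hom.toLinearMap : Set B) = Set.range i.hom := Set.ext hex
  have isClosed_ker : IsClosed (LinearMap.ker p.hom.toLinearMap : Set B) :=
    ker_eq ▸ hi.isClosed_range
  let MA := (hF.comap i.hom.toLinearMap hi).model
  let MC := (hF.map p.hom.toLinearMap hp isClosed_ker).model
  obtain ⟨g, hg⟩ := MA.exists_compat_diagram hF.model i fun _ _ hv => hv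
  obtain ⟨g', hg'⟩ := hF.model.exists_compat_diagram MC p fun _ v hv => ⟨v, hv, rfl⟩
  exact isAdmissibleExact_of_compat hg hg' <| tate_isAdmissibleExact_of_app g g'
    (fun h => hg.app_injective h fun _ hv => hv)
    (fun h => hg.app_exact hg' hex h (fun _ hv => hv) fun _ hu => hu)
    fun h => hg'.app_surjective h fun _ hu => hu

end Diagrams

/-! ### Strict exactness of admissible sequences -/

section Topology

variable {k : Type u} [Field k] [TopologicalSpace k] {A B C : TopModuleCat.{u} k}

theorem isHomeomorph_quotientKerMap_iff (p : B ⟶ C) :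
    IsHomeomorph (quotientKerMap p) ↔ IsOpenQuotientMap p.hom := by
  have hq := (LinearMap.ker p.hom.toLinearMap).isOpenQuotientMap_mkQ
  have comp_mkQ : quotientKerMap p ∘ Submodule.mkQ _ = p.hom := rfl
  have injective : Function.Injective (quotientKerMap p) :=
    LinearMap.ker_eq_bot.1 (Submodule.ker_liftQ_eq_bot' _ _ rfl)
  rw [← comp_mkQ, hq.of_comp_iff]
  exact ⟨fun h => ⟨h.surjective, h.continuous, h.isOpenMap⟩,
    fun h => ⟨h.continuous, h.isOpenMap, injective, h.surjective⟩⟩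

theorem IsCountableLLC.of_isClosedEmbedding (hB : IsCountableLLC k B) (i : A ⟶ B)
    (hi : Topology.IsClosedEmbedding i.hom) : IsCountableLLC k A := by
  obtain ⟨F, hF⟩ := (exists_isLatticeFiltration_iff B).1 hB
  exact (exists_isLatticeFiltration_iff A).2 ⟨_, hF.comap i.hom.toLinearMap hi⟩

theorem IsCountableLLC.of_isOpenQuotientMap (hB : IsCountableLLC k B) (p : B ⟶ C)
    (hp : IsOpenQuotientMap p.hom) (isClosed_ker : IsClosed (p.hom.ker : Set B)) :
    IsCountableLLC k C := by
  obtain ⟨F, hF⟩ := (exists_isLatticeFiltration_iff B).1 hB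
  exact (exists_isLatticeFiltration_iff C).2 ⟨_, hF.map p.hom.toLinearMap hp isClosed_ker⟩

theorem isOpenQuotientMap_of_surjective (hB : IsCountableLLC k B) (hC : IsCountableLLC k C)
    (p : B ⟶ C) (surjective : Function.Surjective p.hom) : IsOpenQuotientMap p.hom := by
  obtain ⟨F, hF⟩ := (exists_isLatticeFiltration_iff B).1 hB
  obtain ⟨G, hG⟩ := (exists_isLatticeFiltration_iff C).1 hC
  have := hC.isLinearTopology
  have := hC.t2Space
  have := hG.baireSpace
  exact ⟨surjective, p.hom.continuous, hF.isOpenMap p.hom.toLinearMap p.hom.continuous surjective⟩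

theorem isClosedEmbedding_of_isClosed_range (hA : IsCountableLLC k A) (hB : IsCountableLLC k B)
    (i : A ⟶ B) (injective : Function.Injective i.hom) (isClosed : IsClosed (Set.range i.hom)) :
    Topology.IsClosedEmbedding i.hom := by
  let R := TopModuleCat.of k i.hom.range
  let ι : R ⟶ B := ConcreteCategory.ofHom (C := TopModuleCat.{u} k) i.hom.range.subtypeL
  let r : A ⟶ R := ConcreteCategory.ofHom (C := TopModuleCat.{u} k)
    (i.hom.codRestrict i.hom.range fun x => ⟨x, rfl⟩)
  have hι : Topology.IsClosedEmbedding ι.hom := isClosed.isClosedEmbedding_subtypeVal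
  have hr := isOpenQuotientMap_of_surjective hA (hB.of_isClosedEmbedding ι hι) r
    i.hom.toLinearMap.surjective_rangeRestrict
  have injective_r : Function.Injective r.hom := fun _ _ h => injective (congrArg Subtype.val h)
  exact hι.comp
    (IsHomeomorph.mk hr.continuous hr.isOpenMap ⟨injective_r, hr.surjective⟩).isClosedEmbedding

end Topology

theorem injective_and_mem_range_iff_of_isPullback {X Y Z O : Type u} [Subsingleton O] {i : X ⟶ Y}
    {p : Y ⟶ Z} {s : X ⟶ O} {t : O ⟶ Z} (h : IsPullback i s p t) (x₀ : X) :
    Function.Injective i ∧ ∀ y, p y = p (i x₀) ↔ y ∈ Set.range i := by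
  obtain ⟨w, hinj, hex⟩ := (Types.isPullback_iff _ _ _ _).1 h
  have w' (x : X) : p (i x) = t (s x₀) :=
    (congrArg (fun f => f x) w).trans (congrArg t (Subsingleton.elim _ _))
  refine ⟨fun x y hxy => hinj x y ⟨hxy, Subsingleton.elim _ _⟩, fun y => ⟨fun hy => ?_, ?_⟩⟩
  · obtain ⟨x, hx, -⟩ := hex y (s x₀) (hy.trans (w' x₀))
    exact ⟨x, hx⟩
  · rintro ⟨x, rfl⟩
    rw [w', w']

section Tate

variable {k : Type u} [Field k]

theorem exists_isZero_toIndPro (k : Type u) [Field k] :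
    ∃ N : Tate k, IsZero ((toIndPro k).obj N) := by
  have isZero : IsZero (FGModuleCat.of k PUnit.{u + 1}) :=
    (IsZero.iff_id_eq_zero _).2 (FGModuleCat.hom_ext (LinearMap.ext fun _ => rfl))
  let N : AdmDiagram k := ⟨(Functor.const Pairs).obj (FGModuleCat.of k PUnit), fun _ _ _ _ _ =>
    ⟨fun _ _ _ => rfl, fun x => ⟨fun _ => ⟨x, rfl⟩, fun _ => rfl⟩,
      fun x => ⟨x, rfl⟩⟩⟩
  exact ⟨(shiftMaps k).Q.obj N,
    isZero_obj_of_isZero (indProLim k) (Functor.isZero N.obj fun _ => isZero)⟩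

variable [TopologicalSpace k] [DiscreteTopology k]

theorem injective_exact_of_tate_isAdmissibleExact {X Y Z : Tate k} {i : X ⟶ Y} {p : Y ⟶ Z}
    (h : Tate.IsAdmissibleExact k i p) :
    Function.Injective ((realization k).map i).hom ∧
      Function.Exact ((realization k).map i).hom ((realization k).map p).hom := by
  obtain ⟨O, hO, s, t, h, -⟩ := h
  have := (Types.isTerminalEquivUnique _
    (hO.isTerminal.isTerminalObj (IndPro.points k))).instSubsingleton
  let α := toIndProCompPoints k
  have pullback : IsPullback ((forgetTop k).map ((realization k).map i))
      ((α.app X).inv ≫ (IndPro.points k).map s) ((forgetTop k).map ((realization k).map p))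
      ((IndPro.points k).map t ≫ (α.app Z).hom) :=
    IsPullback.of_iso (h.map (IndPro.points k)) (α.app X) (α.app Y) (Iso.refl _) (α.app Z)
      (α.hom.naturality i) (by simp) (α.hom.naturality p) (by simp)
  obtain ⟨inj, ex⟩ := injective_and_mem_range_iff_of_isPullback pullback (0 : (realization k).obj X)
  have map_zero : ((realization k).map p).hom (((realization k).map i).hom 0) = 0 := by
    rw [map_zero, map_zero]
  exact ⟨inj, fun y => map_zero ▸ ex y⟩

theorem surjective_realization_map_of_isSplitEpi {Z Z' : Tate k} (q : Z' ⟶ Z)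
    [IsSplitEpi ((toIndPro k).map q)] : Function.Surjective ((realization k).map q).hom := by
  have epi : Epi ((realization k ⋙ forgetTop k).map q) := by
    rw [← NatIso.naturality_1 (toIndProCompPoints k) q, Functor.comp_map]
    infer_instance
  exact (epi_iff_surjective ((forgetTop k).map ((realization k).map q))).1 epi

theorem exists_toIndPro_map_eq_comp {X Y : Tate k} (f : X ⟶ Y) (hf : (realization k).map f = 0) :
    ∃ (N : IndPro k) (_ : IsZero N) (a : (toIndPro k).obj X ⟶ N) (b : N ⟶ (toIndPro k).obj Y),
      (toIndPro k).map f = a ≫ b := by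
  obtain ⟨N, hN⟩ := exists_isZero_toIndPro k
  obtain ⟨a, ha⟩ := (realization k).map_surjective (X := X) (Y := N) 0
  obtain ⟨b, -⟩ := (realization k).map_surjective (X := N) (Y := Y) 0
  have hab : f = a ≫ b :=
    (realization k).map_injective (by rw [hf, Functor.map_comp, ha, zero_comp])
  exact ⟨_, hN, _, _, hab ▸ Functor.map_comp _ a b⟩

theorem isSplitEpi_toIndPro_of_tate_isAdmissibleExact {X Y Z Z' : Tate k} {i : X ⟶ Y} {p : Y ⟶ Z}
    (h : Tate.IsAdmissibleExact k i p) (π : Y ⟶ Z') (q : Z' ⟶ Z) (hπq : π ≫ q = p)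
    (hiπ : (realization k).map (i ≫ π) = 0) : IsSplitEpi ((toIndPro k).map q) := by
  obtain ⟨O, hO, s, t, -, pushout⟩ := h
  obtain ⟨N, hN, a, b, hab⟩ := exists_toIndPro_map_eq_comp (i ≫ π) hiπ
  have comm : (toIndPro k).map i ≫ (toIndPro k).map π = s ≫ hO.to_ N ≫ b := by
    rw [← Functor.map_comp, hab, ← Category.assoc, hN.eq_of_tgt a]
  refine ⟨⟨pushout.desc _ _ comm, pushout.hom_ext ?_ (hO.eq_of_src _ _)⟩⟩
  rw [IsPushout.inl_desc_assoc, ← Functor.map_comp, hπq, Category.comp_id]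

theorem realization_obj_isCountableLLC (T : Tate k) : IsCountableLLC k ((realization k).obj T) :=
  (realization_essImage_iff_isCountableLLC _).1 ((realization k).obj_mem_essImage T)

theorem exists_coimage_factorization {Y Z : Tate k} (p : Y ⟶ Z) :
    ∃ (T : Tate k) (π : Y ⟶ T) (q : T ⟶ Z), π ≫ q = p ∧
      Function.Surjective ((realization k).map π).hom ∧
      ∀ y, ((realization k).map p).hom y = 0 → ((realization k).map π).hom y = 0 := by
  let f : (realization k).obj Y →L[k] (realization k).obj Z := ((realization k).map p).hom
  have := (realization_obj_isCountableLLC Z).t2Space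
  let π₀ : (realization k).obj Y ⟶ TopModuleCat.of k ((realization k).obj Y ⧸ f.ker) :=
    ConcreteCategory.ofHom (C := TopModuleCat.{u} k) f.ker.mkQL
  let q₀ : TopModuleCat.of k ((realization k).obj Y ⧸ f.ker) ⟶ (realization k).obj Z :=
    ConcreteCategory.ofHom (C := TopModuleCat.{u} k) (f.ker.liftQL f le_rfl)
  have hQ : IsCountableLLC k (TopModuleCat.of k ((realization k).obj Y ⧸ f.ker)) :=
    (realization_obj_isCountableLLC Y).of_isOpenQuotientMap π₀ f.ker.isOpenQuotientMap_mkQ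
      (f.ker.ker_mkQ.symm ▸ f.isClosed_ker)
  obtain ⟨T, ⟨e⟩⟩ := (realization_essImage_iff_isCountableLLC _).2 hQ
  obtain ⟨π, hπ⟩ := (realization k).map_surjective (π₀ ≫ e.inv)
  obtain ⟨q, hq⟩ := (realization k).map_surjective (e.hom ≫ q₀)
  refine ⟨T, π, q, (realization k).map_injective ?_, ?_, fun y hy => ?_⟩
  · rw [Functor.map_comp, hπ, hq, Category.assoc, e.inv_hom_id_assoc]
    rfl
  · rw [hπ]
    exact e.symm.toContinuousLinearEquiv.surjective.comp f.ker.mkQ_surjective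
  · rw [hπ]
    exact (congrArg e.inv.hom ((Submodule.Quotient.mk_eq_zero f.ker).2 hy)).trans
      (map_zero e.inv.hom)

theorem surjective_of_tate_isAdmissibleExact {X Y Z : Tate k} {i : X ⟶ Y} {p : Y ⟶ Z}
    (h : Tate.IsAdmissibleExact k i p) : Function.Surjective ((realization k).map p).hom := by
  obtain ⟨T, π, q, rfl, surjective_π, ker_le⟩ := exists_coimage_factorization p
  have hiπ : (realization k).map (i ≫ π) = 0 := by
    rw [Functor.map_comp]
    exact ConcreteCategory.hom_ext _ _ fun x =>
      ker_le _ ((injective_exact_of_tate_isAdmissibleExact h).2.apply_apply_eq_zero x)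
  have := isSplitEpi_toIndPro_of_tate_isAdmissibleExact h π q rfl hiπ
  rw [Functor.map_comp]
  exact (surjective_realization_map_of_isSplitEpi q).comp surjective_π

end Tate

section Realization

variable {k : Type u} [Field k] [TopologicalSpace k] [DiscreteTopology k]
  {A B C : TopModuleCat.{u} k}

theorem IsAdmissibleExact.isCountableLLC {i : A ⟶ B} {p : B ⟶ C} (h : IsAdmissibleExact i p) :
    IsCountableLLC k A ∧ IsCountableLLC k B ∧ IsCountableLLC k C := by
  obtain ⟨X, Y, Z, -, -, -, eA, eB, eC, -, -⟩ := h
  exact ⟨(realization_essImage_iff_isCountableLLC A).1 ⟨X, ⟨eA⟩⟩,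
    (realization_essImage_iff_isCountableLLC B).1 ⟨Y, ⟨eB⟩⟩,
    (realization_essImage_iff_isCountableLLC C).1 ⟨Z, ⟨eC⟩⟩⟩

theorem IsAdmissibleExact.exact {i : A ⟶ B} {p : B ⟶ C} (h : IsAdmissibleExact i p) :
    Function.Injective i.hom ∧ Function.Exact i.hom p.hom ∧ Function.Surjective p.hom := by
  obtain ⟨X, Y, Z, i', p', h, eA, eB, eC, hi, hp⟩ := h
  obtain ⟨inj, ex⟩ := injective_exact_of_tate_isAdmissibleExact h
  have surj := surjective_of_tate_isAdmissibleExact h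
  let a := eA.toContinuousLinearEquiv
  let b := eB.toContinuousLinearEquiv
  let c := eC.toContinuousLinearEquiv
  have hi' : i.hom ∘ a = b ∘ ((realization k).map i').hom :=
    funext fun x => (ConcreteCategory.congr_hom hi x).symm
  have hp' : p.hom ∘ b = c ∘ ((realization k).map p').hom :=
    funext fun x => (ConcreteCategory.congr_hom hp x).symm
  refine ⟨?_, ?_, ?_⟩
  · exact (Function.Injective.of_comp_iff' _ a.bijective).1 (hi' ▸ b.injective.comp inj)
  · exact (Function.Exact.iff_of_ladder_linearEquiv (e₁ := a.toLinearEquiv) (e₂ := b.toLinearEquiv)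
      (e₃ := c.toLinearEquiv) (LinearMap.ext (congrFun hi')) (LinearMap.ext (congrFun hp'))).2 ex
  · exact Function.Surjective.of_comp (hp' ▸ c.surjective.comp surj)

theorem isAdmissibleMono_iff (hA : IsCountableLLC k A) (hB : IsCountableLLC k B) (i : A ⟶ B) :
    IsAdmissibleMono i ↔ Topology.IsClosedEmbedding i.hom := by
  constructor
  · rintro ⟨C, p, h⟩
    have := h.isCountableLLC.2.2.t2Space
    obtain ⟨injective, exact, -⟩ := h.exact
    have range_eq : Set.range i.hom = p.hom.ker := (Set.ext exact).symm
    exact isClosedEmbedding_of_isClosed_range hA hB i injective (range_eq ▸ p.hom.isClosed_ker)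
  · intro hi
    exact ⟨TopModuleCat.of k (B ⧸ i.hom.range),
      ConcreteCategory.ofHom (C := TopModuleCat.{u} k) i.hom.range.mkQL,
      isAdmissibleExact_of_exact hB hi i.hom.range.isOpenQuotientMap_mkQ
        fun _ => Submodule.Quotient.mk_eq_zero i.hom.range⟩

theorem isAdmissibleEpi_iff (hB : IsCountableLLC k B) (hC : IsCountableLLC k C) (p : B ⟶ C) :
    IsAdmissibleEpi p ↔
      Continuous p.hom ∧ Function.Surjective p.hom ∧ IsHomeomorph (quotientKerMap p) := by
  rw [isHomeomorph_quotientKerMap_iff]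
  have := hC.t2Space
  constructor
  · rintro ⟨A, i, h⟩
    exact ⟨p.hom.continuous, h.exact.2.2, isOpenQuotientMap_of_surjective hB hC p h.exact.2.2⟩
  · rintro ⟨-, -, hp⟩
    exact ⟨TopModuleCat.of k p.hom.ker,
      ConcreteCategory.ofHom (C := TopModuleCat.{u} k) p.hom.ker.subtypeL,
      isAdmissibleExact_of_exact hB p.hom.isClosed_ker.isClosedEmbedding_subtypeVal hp
        fun x => ⟨fun hx => ⟨⟨x, hx⟩, rfl⟩, fun ⟨y, hy⟩ => hy ▸ y.2⟩⟩

end Realization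

end

end TateSpaces

theorem mainTheorem9 (k : Type u) [Field k] [TopologicalSpace k] [DiscreteTopology k] :
    -- `Φ` identifies Tate spaces with locally linearly compact spaces of countable type
    ((TateSpaces.realization k).Full ∧ (TateSpaces.realization k).Faithful ∧
      ∀ V : TopModuleCat.{u} k,
        (TateSpaces.realization k).essImage V ↔ TateSpaces.IsCountableLLC k V) ∧
    (∀ A B : TopModuleCat.{u} k, TateSpaces.IsCountableLLC k A → TateSpaces.IsCountableLLC k B →
      ∀ i : A ⟶ B, TateSpaces.IsAdmissibleMono i ↔ Topology.IsClosedEmbedding i.hom) ∧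
    (∀ B C : TopModuleCat.{u} k, TateSpaces.IsCountableLLC k B → TateSpaces.IsCountableLLC k C →
      ∀ p : B ⟶ C, TateSpaces.IsAdmissibleEpi p ↔
        Continuous p.hom ∧ Function.Surjective p.hom ∧
          IsHomeomorph (TateSpaces.quotientKerMap p)) :=
  ⟨⟨TateSpaces.realization_full, TateSpaces.realization_faithful,
      TateSpaces.realization_essImage_iff_isCountableLLC⟩,
    fun _ _ hA hB i => TateSpaces.isAdmissibleMono_iff hA hB i,
    fun _ _ hB hC p => TateSpaces.isAdmissibleEpi_iff hB hC p⟩
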